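/- Let $\Gamma$ be the infinite chain of rings of circumference $2\pi$ indexed by $j\in\mathbb{Z}$, in which rings $j-1$ and $j$ touch at the vertex $j$, so that each ring consists of an upper and a lower semicircle of length $\pi$ joining vertex $j$ to vertex $j+1$, both parametrized from left to right. For $A\in\mathbb{R}$ let $\mathcal{D}=\frac{d}{dx}+iA$ on upper and $\mathcal{D}=\frac{d}{dx}-iA$ on lower semicircles. For a bounded real sequence $(\alpha_j)_{j\in\mathbb{Z}}$ consider the operator $-\mathcal{D}^2$ in $L^2(\Gamma)$ whose domain consists of the $\psi\in L^2(\Gamma)$ that are in $H^2$ on every edge, with $\mathcal{D}^2\psi\in L^2(\Gamma)$, that are continuous at every vertex, and for which at each vertex $j$ the sum of the values of $\mathcal{D}\psi$ on the two edges to the right of it minus the sum of those on the two edges to the left of it equals $\alpha_j\psi(j)$. Denote by $H_{\alpha}$ the operator with $\alpha_j=\alpha\in\mathbb{R}$ for all $j$, and by $H_{\alpha,\gamma_1}$ the operator with $\alpha_1=\alpha+\gamma_1$, $\gamma_1\in\mathbb{R}$, and $\alpha_j=\alpha$ for $j\ne 1$. The essential spectrum is the spectrum without the isolated eigenvalues of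 finite multiplicity; a gap is a connected component of the complement of the essential spectrum in $\mathbb{R}$, and the first gap is the one that lies below the whole essential spectrum. Theorem (Non-magnetic case, single impurity). Suppose that $A\in\mathbb{Z}$. The essential spectrum of $H_{\alpha,\gamma_1}$ coincides with the essential spectrum of $H_\alpha$, which is the whole spectrum of $H_\alpha$. Moreover: 1. if $\alpha>0$ and $\gamma_1>0$, then $H_{\alpha,\gamma_1}$ has no eigenvalues in the gaps of its essential spectrum, and no eigenvalues at all apart from numbers $n^2$, $n\in\{1,2,\dots\}$, that lie in the essential spectrum; 2. if $\alpha>0$ and $\gamma_1<0$, then $H_{\alpha,\gamma_1}$ has precisely one eigenvalue in every gap of its essential spectrum, and this eigenvalue is simple; 3. if $\alpha<0$ and $\gamma_1>0$, then $H_{\alpha,\gamma_1}$ has precisely one eigenvalue in every gap of its essential spectrum except the first one, this eigenvalue is simple, and there is no eigenvalue in the first gap; 4. if $\alpha<0$ and $\gamma_1<0$, then $H_{\alpha,\gamma_1}$ has precisely one eigenvalue below its essential spectrum, this eigenvalue is simple, and $H_{\alpha,\gamma_1}$ has no other eigenvalues apart from numbers $n^2$, $n\in\{1,2,\dots\}$,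 that lie in the essential spectrum. -/

import Mathlib

open MeasureTheory Filter Topology

noncomputable section

/-! ### Spectral notions for a partially defined (unbounded) operator on a Hilbert space -/

namespace UnboundedOp

variable {E : Type*} [NormedAddCommGroup E] [InnerProductSpace ℂ E]

/-- The eigenspace `ker (T - z)`. -/
def eigenspace (T : E →ₗ.[ℂ] E) (z : ℂ) : Submodule ℂ E where
  carrier := {u | (u, z • u) ∈ T.graph}
  add_mem' {u v} hu hv := by
    have h := T.graph.add_mem hu hv
    simpa [smul_add] using h
  zero_mem' := by
    change ((0 : E), z • (0 : E)) ∈ T.graph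
    rw [smul_zero]
    exact T.graph.zero_mem
  smul_mem' c u hu := by
    have h := T.graph.smul_mem c hu
    simpa [smul_comm c z u] using h

/-- `z` is an eigenvalue: `T u = z u` for some `u ≠ 0` in the domain of `T`. -/
def IsEigenvalue (T : E →ₗ.[ℂ] E) (z : ℂ) : Prop :=
  ∃ u : T.domain, (u : E) ≠ 0 ∧ T u = z • (u : E)

/-- `z` is an eigenvalue of multiplicity one. -/
def IsSimpleEigenvalue (T : E →ₗ.[ℂ] E) (z : ℂ) : Prop :=
  IsEigenvalue T z ∧ Module.finrank ℂ (eigenspace T z) = 1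

/-- The resolvent set: those `z` for which `T - z`, as a map from the domain of `T` to the whole
space, has a bounded everywhere defined two-sided inverse `R`. -/
def resolventSet (T : E →ₗ.[ℂ] E) : Set ℂ :=
  {z | ∃ R : E →L[ℂ] E,
    (∀ f : E, ∃ h : R f ∈ T.domain, T ⟨R f, h⟩ - z • R f = f) ∧
    ∀ u : T.domain, R (T u - z • (u : E)) = u}

/-- The spectrum. -/
def spectrum (T : E →ₗ.[ℂ] E) : Set ℂ := (resolventSet T)ᶜ

/-- The discrete spectrum: the eigenvalues of finite multiplicity that are isolated points of the
spectrum. -/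
def discreteSpectrum (T : E →ₗ.[ℂ] E) : Set ℂ :=
  {z | IsEigenvalue T z ∧ FiniteDimensional ℂ (eigenspace T z) ∧
    ∀ᶠ w in 𝓝[≠] z, w ∉ spectrum T}

/-- The essential spectrum: the spectrum without the discrete spectrum. -/
def essSpectrum (T : E →ₗ.[ℂ] E) : Set ℂ := spectrum T \ discreteSpectrum T

/-- `G` is a gap of the essential spectrum: a connected component of its complement in `ℝ`. -/
def IsGap (T : E →ₗ.[ℂ] E) (G : Set ℝ) : Prop :=
  ∃ x : ℝ, (x : ℂ) ∉ essSpectrum T ∧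
    G = connectedComponentIn {y : ℝ | (y : ℂ) ∉ essSpectrum T} x

/-- The first gap: the half-line below the (real) essential spectrum. -/
def firstGap (T : E →ₗ.[ℂ] E) : Set ℝ :=
  {x : ℝ | ∀ y : ℝ, (y : ℂ) ∈ essSpectrum T → x < y}

/-- `T` has precisely one eigenvalue in `G`, and this eigenvalue is simple. -/
def HasUniqueSimpleEigenvalueIn (T : E →ₗ.[ℂ] E) (G : Set ℝ) : Prop :=
  ∃ x ∈ G, IsSimpleEigenvalue T (x : ℂ) ∧ ∀ y ∈ G, IsEigenvalue T (y : ℂ) → y = x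

end UnboundedOp

/-! ### The ring chain and its Hamiltonian -/

namespace RingChain

/-- The edges of the chain: the edge `(j, true)` is the upper and `(j, false)` the lower semicircle
of the `j`-th ring. Every edge is parametrized from left to right by `[0, π]`; the vertex with
index `j` is the left end of the two edges of ring `j` and the right end of the two edges of
ring `j - 1`. -/
abbrev Edge : Type := ℤ × Bool

/-- Arc length on one edge. -/
abbrev edgeMeasure : Measure ℝ := volume.restrict (Set.Icc 0 Real.pi)

/-- The state space `L²(Γ)`, the Hilbert sum of the spaces `L²(e)` over all edges. -/
abbrev L2Chain : Type := lp (fun _ : Edge => Lp ℂ 2 edgeMeasure) 2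

/-- `f` is absolutely continuous on `[0, π]` and `g` is (almost everywhere) its derivative. -/
def HasACDeriv (f g : ℝ → ℂ) : Prop :=
  IntervalIntegrable g volume 0 Real.pi ∧
    ∀ x ∈ Set.Icc 0 Real.pi, f x = f 0 + ∫ t in (0 : ℝ)..x, g t

/-- The quasiderivative is `𝓓 = d/dx + quasiCoeff A s`: it is `d/dx + iA` on the upper and
`d/dx - iA` on the lower semicircles. -/
def quasiCoeff (A : ℝ) (s : Bool) : ℂ :=
  if s then Complex.I * (A : ℂ) else -(Complex.I * (A : ℂ))

/-- `ψ` is a function on the chain with quasiderivative `η = 𝓓ψ` on every edge such that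
`-𝓓²ψ = v`, and `ψ` satisfies the `δ`-coupling of strength `α j` at the vertex `j` for all `j`.
As `v` is square integrable, the functions `ψ e` are in the Sobolev space `H²(0, π)`. -/
structure IsSolution (A : ℝ) (α : ℤ → ℝ) (ψ η : Edge → ℝ → ℂ) (v : L2Chain) : Prop where
  deriv_fst : ∀ e : Edge, HasACDeriv (ψ e) (fun x => η e x - quasiCoeff A e.2 * ψ e x)
  deriv_snd : ∀ e : Edge, HasACDeriv (η e) (fun x => -(v e x) - quasiCoeff A e.2 * η e x)
  lower_eq : ∀ j : ℤ, ψ (j, false) 0 = ψ (j, true) 0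
  upper_left_eq : ∀ j : ℤ, ψ (j - 1, true) Real.pi = ψ (j, true) 0
  lower_left_eq : ∀ j : ℤ, ψ (j - 1, false) Real.pi = ψ (j, true) 0
  coupling : ∀ j : ℤ,
    η (j, true) 0 + η (j, false) 0 - η (j - 1, true) Real.pi - η (j - 1, false) Real.pi =
      (α j : ℂ) * ψ (j, true) 0

theorem HasACDeriv.congr_ae {f g g' : ℝ → ℂ} (h : HasACDeriv f g)
    (hg : g =ᵐ[edgeMeasure] g') : HasACDeriv f g' := by
  have hpi : (0 : ℝ) ≤ Real.pi := Real.pi_pos.le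
  have hres : ∀ x ∈ Set.Icc 0 Real.pi, g =ᵐ[volume.restrict (Set.uIoc 0 x)] g' := by
    intro x hx
    refine ae_restrict_of_ae_restrict_of_subset ?_ hg
    rw [Set.uIoc_of_le hx.1]
    exact fun t ht => ⟨ht.1.le, ht.2.trans hx.2⟩
  refine ⟨h.1.congr_ae (hres _ ⟨hpi, le_rfl⟩), fun x hx => ?_⟩
  rw [h.2 x hx, intervalIntegral.integral_congr_ae_restrict (hres x hx)]

theorem HasACDeriv.add {f g f' g' : ℝ → ℂ} (h : HasACDeriv f g) (h' : HasACDeriv f' g') :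
    HasACDeriv (fun x => f x + f' x) (fun x => g x + g' x) := by
  refine ⟨h.1.add h'.1, fun x hx => ?_⟩
  have hsub : Set.uIcc 0 x ⊆ Set.uIcc 0 Real.pi :=
    Set.uIcc_subset_uIcc_left (by rw [Set.uIcc_of_le Real.pi_pos.le]; exact hx)
  change f x + f' x = f 0 + f' 0 + _
  rw [intervalIntegral.integral_add (h.1.mono_set hsub) (h'.1.mono_set hsub), h.2 x hx,
    h'.2 x hx]
  ring

theorem HasACDeriv.const_mul {f g : ℝ → ℂ} (h : HasACDeriv f g) (c : ℂ) :
    HasACDeriv (fun x => c * f x) (fun x => c * g x) := by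
  refine ⟨h.1.const_mul c, fun x hx => ?_⟩
  change c * f x = c * f 0 + _
  rw [intervalIntegral.integral_const_mul, h.2 x hx]
  ring

theorem HasACDeriv.eq_zero {f g : ℝ → ℂ} (h : HasACDeriv f g) (hf : f =ᵐ[edgeMeasure] 0) :
    g =ᵐ[edgeMeasure] 0 := by
  have hpi := Real.pi_pos
  have hcont : ContinuousOn f (Set.Icc 0 Real.pi) := by
    have h1 := intervalIntegral.continuousOn_primitive_interval'
      (μ := volume) (a := 0) (b₁ := 0) (b₂ := Real.pi) (f := g) h.1 (by simp)
    rw [Set.uIcc_of_le hpi.le] at h1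
    exact (h1.const_add (f 0)).congr fun x hx => h.2 x hx
  have hzero : Set.EqOn f 0 (Set.Icc 0 Real.pi) :=
    Measure.eqOn_Icc_of_ae_eq volume hpi.ne hf hcont continuousOn_const
  have hint : ∀ x ∈ Set.Icc 0 Real.pi, ∫ t in (0 : ℝ)..x, g t = 0 := by
    intro x hx
    have h2 := h.2 x hx
    rw [hzero hx, hzero ⟨le_rfl, hpi.le⟩] at h2
    simpa using h2.symm
  have hae := h.1.ae_hasDerivAt_integral
  have key : ∀ᵐ x ∂(volume.restrict (Set.Ioo 0 Real.pi)), g x = 0 := by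
    rw [ae_restrict_iff' measurableSet_Ioo]
    filter_upwards [hae] with x hx hx'
    have hd := hx (by rw [Set.uIcc_of_le hpi.le]; exact Set.Ioo_subset_Icc_self hx') 0 (by simp)
    have he : (fun y => ∫ t in (0 : ℝ)..y, g t) =ᶠ[𝓝 x] fun _ => (0 : ℂ) := by
      filter_upwards [Ioo_mem_nhds hx'.1 hx'.2] with y hy
      exact hint y (Set.Ioo_subset_Icc_self hy)
    exact hd.unique ((hasDerivAt_const x (0 : ℂ)).congr_of_eventuallyEq he)
  have hm : volume.restrict (Set.Ioo 0 Real.pi) = volume.restrict (Set.Icc 0 Real.pi) :=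
    restrict_Ioo_eq_restrict_Icc
  rw [hm] at key
  exact key

/-- The graph of the magnetic Laplacian `-Δ_α` with vector potential `A` and coupling constants
`α j`: the pairs `(u, v)` in `L²(Γ)` such that `u` has a representative in `H²` on every edge that
satisfies the coupling conditions, and `v = -𝓓²u`. -/
def hamiltonianGraph (A : ℝ) (α : ℤ → ℝ) : Submodule ℂ (L2Chain × L2Chain) where
  carrier := {p | ∃ ψ η : Edge → ℝ → ℂ,
    (∀ e, (p.1 e : ℝ → ℂ) =ᵐ[edgeMeasure] ψ e) ∧ IsSolution A α ψ η p.2}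
  add_mem' := by
    rintro p q ⟨ψ, η, hp, h⟩ ⟨ψ', η', hq, h'⟩
    refine ⟨fun e x => ψ e x + ψ' e x, fun e x => η e x + η' e x, fun e => ?_,
      fun e => ?_, fun e => ?_, fun j => ?_, fun j => ?_, fun j => ?_, fun j => ?_⟩
    · filter_upwards [Lp.coeFn_add (p.1 e) (q.1 e), hp e, hq e] with x h1 h2 h3
      change ((p.1 e + q.1 e : Lp ℂ 2 edgeMeasure) : ℝ → ℂ) x = _
      rw [h1, Pi.add_apply, h2, h3]
    · refine ((h.deriv_fst e).add (h'.deriv_fst e)).congr_ae (Eventually.of_forall fun x => ?_)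
      simp only
      ring
    · refine ((h.deriv_snd e).add (h'.deriv_snd e)).congr_ae ?_
      filter_upwards [Lp.coeFn_add (p.2 e) (q.2 e)] with x h1
      change _ = -(((p.2 e + q.2 e : Lp ℂ 2 edgeMeasure) : ℝ → ℂ) x) - _
      rw [h1, Pi.add_apply]
      ring
    · simp only [h.lower_eq, h'.lower_eq]
    · simp only [h.upper_left_eq, h'.upper_left_eq]
    · simp only [h.lower_left_eq, h'.lower_left_eq]
    · linear_combination h.coupling j + h'.coupling j
  zero_mem' := by
    refine ⟨fun _ _ => 0, fun _ _ => 0, fun e => ?_, fun e => ?_, fun e => ?_,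
      fun j => rfl, fun j => rfl, fun j => rfl, fun j => by simp⟩
    · exact Lp.coeFn_zero ℂ 2 edgeMeasure
    · exact ⟨by simp, fun x _ => by simp⟩
    · have h0 : HasACDeriv (fun _ => 0) (fun _ => 0) := ⟨by simp, fun x _ => by simp⟩
      refine h0.congr_ae ?_
      filter_upwards [Lp.coeFn_zero ℂ 2 edgeMeasure] with x h1
      change _ = -(((0 : Lp ℂ 2 edgeMeasure) : ℝ → ℂ) x) - _
      rw [h1]
      simp
  smul_mem' := by
    rintro c p ⟨ψ, η, hp, h⟩
    refine ⟨fun e x => c * ψ e x, fun e x => c * η e x, fun e => ?_,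
      fun e => ?_, fun e => ?_, fun j => ?_, fun j => ?_, fun j => ?_, fun j => ?_⟩
    · filter_upwards [Lp.coeFn_smul c (p.1 e), hp e] with x h1 h2
      change ((c • p.1 e : Lp ℂ 2 edgeMeasure) : ℝ → ℂ) x = _
      rw [h1, Pi.smul_apply, h2, smul_eq_mul]
    · refine ((h.deriv_fst e).const_mul c).congr_ae (Eventually.of_forall fun x => ?_)
      simp only
      ring
    · refine ((h.deriv_snd e).const_mul c).congr_ae ?_
      filter_upwards [Lp.coeFn_smul c (p.2 e)] with x h1
      change _ = -(((c • p.2 e : Lp ℂ 2 edgeMeasure) : ℝ → ℂ) x) - _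
      rw [h1, Pi.smul_apply, smul_eq_mul]
      ring
    · simp only [h.lower_eq]
    · simp only [h.upper_left_eq]
    · simp only [h.lower_left_eq]
    · linear_combination c * h.coupling j

/-- `-𝓓²u` is determined by `u`. -/
theorem hamiltonianGraph_single_valued (A : ℝ) (α : ℤ → ℝ) (p : L2Chain × L2Chain)
    (hp : p ∈ hamiltonianGraph A α) (h0 : p.1 = 0) : p.2 = 0 := by
  obtain ⟨ψ, η, hu, h⟩ := hp
  apply lp.ext
  funext e
  have hψ : ψ e =ᵐ[edgeMeasure] 0 := by
    filter_upwards [hu e, Lp.coeFn_zero ℂ 2 edgeMeasure] with x h1 h2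
    rw [h0] at h1
    rw [← h1]
    exact h2
  have hη : η e =ᵐ[edgeMeasure] 0 := by
    filter_upwards [(h.deriv_fst e).eq_zero hψ, hψ] with x h1 h2
    simpa [h2] using h1
  have hv : ((p.2 e : Lp ℂ 2 edgeMeasure) : ℝ → ℂ) =ᵐ[edgeMeasure] 0 := by
    filter_upwards [(h.deriv_snd e).eq_zero hη, hη] with x h1 h2
    simpa [h2] using h1
  exact (Lp.eq_zero_iff_ae_eq_zero).2 hv

/-- The magnetic Laplacian `-Δ_α` on the ring chain, as an operator in `L²(Γ)`. -/
def hamiltonian (A : ℝ) (α : ℤ → ℝ) : L2Chain →ₗ.[ℂ] L2Chain :=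
  (hamiltonianGraph A α).toLinearPMap

theorem hamiltonian_graph (A : ℝ) (α : ℤ → ℝ) :
    (hamiltonian A α).graph = hamiltonianGraph A α :=
  Submodule.toLinearPMap_graph_eq _ (hamiltonianGraph_single_valued A α)

/-- The unperturbed operator: the same coupling constant `α` at all vertices. -/
def periodicHamiltonian (A α : ℝ) : L2Chain →ₗ.[ℂ] L2Chain :=
  hamiltonian A fun _ => α

/-- The operator with a single impurity of strength `γ`: the coupling constant is `α + γ` at the
vertex with index `1` and `α` at all other vertices. -/
def impurityHamiltonian (A α γ : ℝ) : L2Chain →ₗ.[ℂ] L2Chain :=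
  hamiltonian A fun j => if j = 1 then α + γ else α

end RingChain

end

/-!
On an edge the equation `-𝒟²ψ - z ψ = f` is solved explicitly, so an element of the domain is
determined by its values at the vertices, and the Kirchhoff conditions become a difference equation
`u (j - 1) + u (j + 1) - 2 D u j - (γ / 2) (sin (√z π) / √z) δ_{j1} u j = g j` in `ℓ²(ℤ)`, where
`D = cos (√z π) + (α / 4) sin (√z π) / √z` is the discriminant (up to the sign `(-1) ^ A`, which
is where `A ∈ ℤ` enters). For `γ = 0` it is uniquely solvable exactly off the bands
`D ∈ [-1, 1]`. At `z = n ^ 2` the edge equation degenerates, and sine functions supported on a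
single ring give infinitely many eigenfunctions.

Off the bands, with `P = α / 4 - √z tan (√z π / 2)` and `Q = α / 4 + cot (√z π / 2) / √z`, one has
`D - 1 = P sin (√z π) / √z` and `D + 1 = Q sin (√z π) / √z`, so the gaps are given by `P Q > 0`.
An `ℓ²` solution of the homogeneous equation decays geometrically on both sides of the impurity,
and matching the two sides shows that `x` is an eigenvalue if and only if `P Q = γ ^ 2 / 16` and
`γ P < 0`. By Wronskian identities `P` and `Q` are strictly decreasing between consecutive points
`n ^ 2`, and they have imaginary parts of constant sign in each half plane. This gives uniqueness in
a gap and excludes nonreal eigenvalues. For existence, one moves within `(n ^ 2, (n + 1) ^ 2)` from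
a point with `γ P < 0` and `γ Q < 0` in the direction in which `-γ P` and `-γ Q` grow until their
product is large, and in the opposite direction until their sum vanishes. The signs of `P` in the
gaps then distinguish the four cases.
-/

noncomputable section

namespace RingChain

/-! ### The fundamental system of `-y'' = z y` -/

/-- The entire function `sin u / u`, with the value `1` at `u = 0`. -/
def csinc : ℂ → ℂ := dslope Complex.sin 0

theorem mul_csinc (u : ℂ) : u * csinc u = Complex.sin u := by
  simpa [csinc] using sub_smul_dslope Complex.sin 0 u

@[simp] theorem csinc_zero : csinc 0 = 1 := by
  simp [csinc, dslope_same]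

theorem continuous_csinc : Continuous csinc :=
  continuousOn_univ.1 <| (continuousOn_dslope univ_mem).2
    ⟨Complex.continuous_sin.continuousOn, Complex.differentiable_sin 0⟩

theorem csinc_neg (u : ℂ) : csinc (-u) = csinc u := by
  rcases eq_or_ne u 0 with rfl | hu
  · simp
  · exact mul_left_cancel₀ hu (by
      linear_combination mul_csinc (-u) * -1 - mul_csinc u - Complex.sin_neg u)

theorem csinc_conj (u : ℂ) :
    csinc ((starRingEnd ℂ) u) = (starRingEnd ℂ) (csinc u) := by
  rcases eq_or_ne u 0 with rfl | hu
  · simp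
  · refine mul_left_cancel₀ (star_ne_zero.2 hu) ?_
    rw [← starRingEnd_apply, ← map_mul, mul_csinc, mul_csinc, Complex.sin_conj]

theorem csinc_two_mul (u : ℂ) : csinc (2 * u) = csinc u * Complex.cos u := by
  rcases eq_or_ne u 0 with rfl | hu
  · simp
  · refine mul_left_cancel₀ (mul_ne_zero two_ne_zero hu) ?_
    linear_combination mul_csinc (2 * u) - 2 * Complex.cos u * mul_csinc u + Complex.sin_two_mul u

theorem csqrt_sq (z : ℂ) : z.sqrt ^ 2 = z := by
  simp [Complex.sqrt]

theorem continuous_sqrt_ofReal : Continuous fun r : ℝ => Complex.sqrt r := by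
  simp only [Complex.sqrt_eq_real_add_ite, Complex.ofReal_im, Complex.ofReal_re, le_refl, if_true]
  fun_prop

/-- The solution of `-y'' = z y` with `y 0 = 1`, `y' 0 = 0`. Being even in the square root, it does
not depend on the branch. -/
def cosRoot (z : ℂ) (x : ℝ) : ℂ := Complex.cos (z.sqrt * x)

/-- The solution of `-y'' = z y` with `y 0 = 0`, `y' 0 = 1`, that is `sin (√z x) / √z`. -/
def sinRoot (z : ℂ) (x : ℝ) : ℂ := x * csinc (z.sqrt * x)

theorem cosRoot_sq (k : ℂ) (x : ℝ) : cosRoot (k ^ 2) x = Complex.cos (k * x) := by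
  rcases sq_eq_sq_iff_eq_or_eq_neg.1 (csqrt_sq (k ^ 2)) with h | h <;> simp [cosRoot, h]

theorem sinRoot_sq (k : ℂ) (x : ℝ) : sinRoot (k ^ 2) x = x * csinc (k * x) := by
  rcases sq_eq_sq_iff_eq_or_eq_neg.1 (csqrt_sq (k ^ 2)) with h | h <;>
    simp [sinRoot, h, csinc_neg]

theorem mul_sinRoot_sq (k : ℂ) (x : ℝ) : k * sinRoot (k ^ 2) x = Complex.sin (k * x) := by
  rw [sinRoot_sq, ← mul_csinc, mul_assoc]

theorem sqrt_mul_sinRoot (z : ℂ) (x : ℝ) : z.sqrt * sinRoot z x = Complex.sin (z.sqrt * x) := by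
  rw [← mul_sinRoot_sq, csqrt_sq]

@[simp] theorem cosRoot_zero_right (z : ℂ) : cosRoot z 0 = 1 := by simp [cosRoot]

@[simp] theorem sinRoot_zero_right (z : ℂ) : sinRoot z 0 = 0 := by simp [sinRoot]

theorem cosRoot_sq_add (z : ℂ) (x : ℝ) : cosRoot z x ^ 2 + z * sinRoot z x ^ 2 = 1 := by
  have h := Complex.cos_sq_add_sin_sq (z.sqrt * x)
  rw [← sqrt_mul_sinRoot] at h
  rw [cosRoot]
  linear_combination h - sinRoot z x ^ 2 * csqrt_sq z

theorem cosRoot_two_mul (z : ℂ) (x : ℝ) :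
    cosRoot z (2 * x) = cosRoot z x ^ 2 - z * sinRoot z x ^ 2 := by
  have h := Complex.cos_two_mul' (z.sqrt * x)
  rw [← sqrt_mul_sinRoot] at h
  rw [cosRoot, Complex.ofReal_mul, Complex.ofReal_ofNat, mul_left_comm, h, cosRoot]
  linear_combination -sinRoot z x ^ 2 * csqrt_sq z

theorem sinRoot_two_mul (z : ℂ) (x : ℝ) :
    sinRoot z (2 * x) = 2 * sinRoot z x * cosRoot z x := by
  rw [sinRoot, Complex.ofReal_mul, Complex.ofReal_ofNat, mul_left_comm, csinc_two_mul, sinRoot,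
    cosRoot]
  ring

theorem hasDerivAt_const_mul_ofReal (k : ℂ) (x : ℝ) :
    HasDerivAt (fun y : ℝ => k * (y : ℂ)) k x := by
  simpa using ((hasDerivAt_id (x : ℂ)).const_mul k).comp_ofReal

theorem hasDerivAt_cosRoot (z : ℂ) (x : ℝ) :
    HasDerivAt (cosRoot z) (-(z * sinRoot z x)) x := by
  refine ((Complex.hasDerivAt_cos _).comp x (hasDerivAt_const_mul_ofReal z.sqrt x)).congr_deriv ?_
  rw [← sqrt_mul_sinRoot]
  linear_combination -sinRoot z x * csqrt_sq z

theorem hasDerivAt_sinRoot (z : ℂ) (x : ℝ) :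
    HasDerivAt (sinRoot z) (cosRoot z x) x := by
  rcases eq_or_ne z.sqrt 0 with h0 | h0
  · have hid : sinRoot z = fun y : ℝ => 1 * (y : ℂ) := funext fun y => by simp [sinRoot, h0]
    simpa only [hid, cosRoot, h0, zero_mul, Complex.cos_zero] using hasDerivAt_const_mul_ofReal 1 x
  · have hsin := (Complex.hasDerivAt_sin _).comp x (hasDerivAt_const_mul_ofReal z.sqrt x)
    have hdiv : sinRoot z = fun y : ℝ => Complex.sin (z.sqrt * y) / z.sqrt :=
      funext fun y => by rw [← sqrt_mul_sinRoot, mul_div_cancel_left₀ _ h0]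
    rw [hdiv]
    exact (hsin.div_const z.sqrt).congr_deriv (mul_div_cancel_right₀ _ h0)

@[fun_prop]
theorem continuous_cosRoot (z : ℂ) : Continuous (cosRoot z) :=
  continuous_iff_continuousAt.2 fun x => (hasDerivAt_cosRoot z x).continuousAt

@[fun_prop]
theorem continuous_sinRoot (z : ℂ) : Continuous (sinRoot z) :=
  continuous_iff_continuousAt.2 fun x => (hasDerivAt_sinRoot z x).continuousAt

theorem cosRoot_conj (z : ℂ) (x : ℝ) :
    cosRoot ((starRingEnd ℂ) z) x = (starRingEnd ℂ) (cosRoot z x) := by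
  nth_rw 1 [← csqrt_sq z]
  rw [map_pow, cosRoot_sq, cosRoot, ← Complex.cos_conj, map_mul, Complex.conj_ofReal]

theorem sinRoot_conj (z : ℂ) (x : ℝ) :
    sinRoot ((starRingEnd ℂ) z) x = (starRingEnd ℂ) (sinRoot z x) := by
  nth_rw 1 [← csqrt_sq z]
  rw [map_pow, sinRoot_sq, sinRoot, map_mul, ← csinc_conj, map_mul, Complex.conj_ofReal]

/-- The function `cosRoot` at a real spectral parameter, as a real function. -/
def realCosRoot (r x : ℝ) : ℝ := (cosRoot r x).re

/-- The function `sinRoot` at a real spectral parameter, as a real function. -/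
def realSinRoot (r x : ℝ) : ℝ := (sinRoot r x).re

theorem ofReal_realCosRoot (r x : ℝ) : (realCosRoot r x : ℂ) = cosRoot r x :=
  Complex.conj_eq_iff_re.1 (by rw [← cosRoot_conj, Complex.conj_ofReal])

theorem ofReal_realSinRoot (r x : ℝ) : (realSinRoot r x : ℂ) = sinRoot r x :=
  Complex.conj_eq_iff_re.1 (by rw [← sinRoot_conj, Complex.conj_ofReal])

theorem continuous_realCosRoot : Continuous fun p : ℝ × ℝ => realCosRoot p.1 p.2 := by
  have h : Continuous fun p : ℝ × ℝ => Complex.sqrt p.1 :=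
    continuous_sqrt_ofReal.comp continuous_fst
  unfold realCosRoot cosRoot
  fun_prop

theorem continuous_realSinRoot : Continuous fun p : ℝ × ℝ => realSinRoot p.1 p.2 := by
  have h : Continuous fun p : ℝ × ℝ => Complex.sqrt p.1 :=
    continuous_sqrt_ofReal.comp continuous_fst
  have := continuous_csinc
  unfold realSinRoot sinRoot
  fun_prop

/-! ### Absolutely continuous functions on an edge -/

theorem absolutelyContinuousOnInterval_of_dist_le {X Y : Type*} [PseudoMetricSpace X]
    [PseudoMetricSpace Y] {f : ℝ → X} {g : ℝ → Y} {a b : ℝ}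
    (hg : AbsolutelyContinuousOnInterval g a b)
    (h : ∀ x ∈ Set.uIcc a b, ∀ y ∈ Set.uIcc a b, dist (f x) (f y) ≤ dist (g x) (g y)) :
    AbsolutelyContinuousOnInterval f a b := by
  rw [absolutelyContinuousOnInterval_iff] at hg ⊢
  intro ε hε
  obtain ⟨δ, hδ, hlt⟩ := hg ε hε
  refine ⟨δ, hδ, fun E hE hlen => (Finset.sum_le_sum fun i hi => ?_).trans_lt (hlt E hE hlen)⟩
  exact h _ (hE.1 i hi).1 _ (hE.1 i hi).2

theorem absolutelyContinuousOnInterval_of_eq_primitive {E : Type*} [NormedAddCommGroup E]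
    [NormedSpace ℝ E] {f g : ℝ → E} {a b : ℝ} (hg : IntervalIntegrable g volume a b)
    (hf : ∀ x ∈ Set.uIcc a b, f x = f a + ∫ t in a..x, g t) :
    AbsolutelyContinuousOnInterval f a b := by
  refine absolutelyContinuousOnInterval_of_dist_le
    (hg.norm.absolutelyContinuousOnInterval_intervalIntegral Set.left_mem_uIcc)
    fun x hx y hy => ?_
  have hint : ∀ u ∈ Set.uIcc a b, IntervalIntegrable g volume a u := fun u hu =>
    hg.mono_set (Set.uIcc_subset_uIcc_left hu)
  rw [hf x hx, hf y hy, dist_add_left, dist_eq_norm, Real.dist_eq,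
    intervalIntegral.integral_interval_sub_left (hint x hx) (hint y hy),
    intervalIntegral.integral_interval_sub_left (hint x hx).norm (hint y hy).norm]
  exact intervalIntegral.norm_integral_le_abs_integral_norm

theorem uIcc_zero_pi : Set.uIcc 0 Real.pi = Set.Icc 0 Real.pi := Set.uIcc_of_le Real.pi_pos.le

theorem HasACDeriv.absolutelyContinuousOnInterval {f g : ℝ → ℂ} (h : HasACDeriv f g) :
    AbsolutelyContinuousOnInterval f 0 Real.pi :=
  absolutelyContinuousOnInterval_of_eq_primitive h.1 fun x hx => h.2 x (uIcc_zero_pi ▸ hx)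

theorem HasACDeriv.continuousOn {f g : ℝ → ℂ} (h : HasACDeriv f g) :
    ContinuousOn f (Set.Icc 0 Real.pi) :=
  uIcc_zero_pi ▸ h.absolutelyContinuousOnInterval.continuousOn

theorem HasACDeriv.eqOn_zero {f g : ℝ → ℂ} (h : HasACDeriv f g) (hf : f =ᵐ[edgeMeasure] 0) :
    Set.EqOn f 0 (Set.Icc 0 Real.pi) :=
  Measure.eqOn_Icc_of_ae_eq volume Real.pi_pos.ne hf h.continuousOn continuousOn_const

theorem HasACDeriv.ae_hasDerivAt {f g : ℝ → ℂ} (h : HasACDeriv f g) :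
    ∀ᵐ x, x ∈ Set.Ioo 0 Real.pi → HasDerivAt f (g x) x := by
  filter_upwards [h.1.ae_hasDerivAt_integral] with x hderiv hx
  have hprim := hderiv (uIcc_zero_pi ▸ Set.Ioo_subset_Icc_self hx) 0 Set.left_mem_uIcc
  refine (hprim.const_add (f 0)).congr_of_eventuallyEq ?_
  filter_upwards [Ioo_mem_nhds hx.1 hx.2] with y hy
  exact h.2 y (Set.Ioo_subset_Icc_self hy)

theorem ae_mem_Ioo_of_mem_Icc (a b : ℝ) : ∀ᵐ x, x ∈ Set.Icc a b → x ∈ Set.Ioo a b := by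
  filter_upwards [compl_mem_ae_iff.2 (measure_singleton a),
    compl_mem_ae_iff.2 (measure_singleton b)] with x ha hb hx
  exact ⟨hx.1.lt_of_ne' ha, hx.2.lt_of_ne hb⟩

theorem hasACDeriv_primitive {g : ℝ → ℂ} (hg : IntervalIntegrable g volume 0 Real.pi) (a : ℂ) :
    HasACDeriv (fun x => a + ∫ t in (0 : ℝ)..x, g t) g :=
  ⟨hg, fun x _ => by simp⟩

theorem hasACDeriv_of_ae_hasDerivAt {f g : ℝ → ℂ}
    (hf : AbsolutelyContinuousOnInterval f 0 Real.pi)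
    (hg : IntervalIntegrable g volume 0 Real.pi)
    (hderiv : ∀ᵐ x, x ∈ Set.Ioo 0 Real.pi → HasDerivAt f (g x) x) : HasACDeriv f g := by
  have hprim := hasACDeriv_primitive hg 0
  obtain ⟨C, hC⟩ := (hf.sub hprim.absolutelyContinuousOnInterval).const_of_ae_hasDerivAt_zero <| by
    filter_upwards [hderiv, hprim.ae_hasDerivAt, ae_mem_Ioo_of_mem_Icc 0 Real.pi]
      with x hfx hpx hIoo hx
    have hx' := hIoo (uIcc_zero_pi ▸ hx)
    simpa using (hfx hx').sub (hpx hx')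
  refine ⟨hg, fun x hx => ?_⟩
  have hx' := hC x (uIcc_zero_pi ▸ hx)
  have h0 := hC 0 Set.left_mem_uIcc
  simp only [Pi.sub_apply, intervalIntegral.integral_same, sub_zero, zero_add] at hx' h0
  rw [h0, ← hx', sub_add_cancel]

theorem hasACDeriv_of_hasDerivAt {f f' : ℝ → ℂ} (hf : ∀ x, HasDerivAt f (f' x) x)
    (hf' : Continuous f') : HasACDeriv f f' :=
  ⟨hf'.intervalIntegrable _ _, fun x _ => by
    rw [intervalIntegral.integral_eq_sub_of_hasDerivAt (fun t _ => hf t)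
      (hf'.intervalIntegrable _ _), add_sub_cancel]⟩

theorem HasACDeriv.mul {f g f' g' : ℝ → ℂ} (hf : HasACDeriv f f') (hg : HasACDeriv g g') :
    HasACDeriv (fun x => f x * g x) (fun x => f' x * g x + f x * g' x) := by
  refine hasACDeriv_of_ae_hasDerivAt
    (hf.absolutelyContinuousOnInterval.smul hg.absolutelyContinuousOnInterval)
    ((hf.1.mul_continuousOn (uIcc_zero_pi ▸ hg.continuousOn)).add
      (hg.1.continuousOn_mul (uIcc_zero_pi ▸ hf.continuousOn))) ?_
  filter_upwards [hf.ae_hasDerivAt, hg.ae_hasDerivAt] with x hfx hgx hx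
  exact (hfx hx).mul (hgx hx)

/-! ### Solutions on a single edge -/

/-- Variation of constants: the solution of `-y'' - z y = f` with `y 0 = a`, `y' 0 = b`. -/
def freeSol (z a b : ℂ) (f : ℝ → ℂ) (x : ℝ) : ℂ :=
  sinRoot z x * (b - ∫ t in (0 : ℝ)..x, cosRoot z t * f t) +
    cosRoot z x * (a + ∫ t in (0 : ℝ)..x, sinRoot z t * f t)

/-- The derivative of `freeSol`. -/
def freeDer (z a b : ℂ) (f : ℝ → ℂ) (x : ℝ) : ℂ :=
  cosRoot z x * (b - ∫ t in (0 : ℝ)..x, cosRoot z t * f t) -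
    z * sinRoot z x * (a + ∫ t in (0 : ℝ)..x, sinRoot z t * f t)

theorem hasACDeriv_cosRoot (z : ℂ) : HasACDeriv (cosRoot z) (fun x => -(z * sinRoot z x)) :=
  hasACDeriv_of_hasDerivAt (hasDerivAt_cosRoot z) (by fun_prop)

theorem hasACDeriv_sinRoot (z : ℂ) : HasACDeriv (sinRoot z) (cosRoot z) :=
  hasACDeriv_of_hasDerivAt (hasDerivAt_sinRoot z) (by fun_prop)

section FreeSolution

variable {z : ℂ} {f : ℝ → ℂ} (hf : IntervalIntegrable f volume 0 Real.pi) (a b : ℂ)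
include hf

theorem hasACDeriv_cosCoeff : HasACDeriv (fun x => b - ∫ t in (0 : ℝ)..x, cosRoot z t * f t)
    (fun x => -(cosRoot z x * f x)) := by
  have h : HasACDeriv (fun x => b + ∫ t in (0 : ℝ)..x, -(cosRoot z t * f t))
      (fun x => -(cosRoot z x * f x)) :=
    hasACDeriv_primitive (hf.continuousOn_mul (continuous_cosRoot z).continuousOn).neg b
  simpa only [intervalIntegral.integral_neg, ← sub_eq_add_neg] using h

theorem hasACDeriv_sinCoeff : HasACDeriv (fun x => a + ∫ t in (0 : ℝ)..x, sinRoot z t * f t)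
    (fun x => sinRoot z x * f x) :=
  hasACDeriv_primitive (hf.continuousOn_mul (continuous_sinRoot z).continuousOn) a

theorem hasACDeriv_freeSol : HasACDeriv (freeSol z a b f) (freeDer z a b f) := by
  refine (((hasACDeriv_sinRoot z).mul (hasACDeriv_cosCoeff hf b)).add
    ((hasACDeriv_cosRoot z).mul (hasACDeriv_sinCoeff hf a))).congr_ae (.of_forall fun x => ?_)
  simp only [freeDer]
  ring

theorem hasACDeriv_freeDer :
    HasACDeriv (freeDer z a b f) (fun x => -(f x + z * freeSol z a b f x)) := by
  have h := ((hasACDeriv_cosRoot z).mul (hasACDeriv_cosCoeff (z := z) hf b)).add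
    (((hasACDeriv_sinRoot z).mul (hasACDeriv_sinCoeff (z := z) hf a)).const_mul (-z))
  have hDer : freeDer z a b f = fun x => cosRoot z x * (b - ∫ t in (0 : ℝ)..x, cosRoot z t * f t) +
      -z * (sinRoot z x * (a + ∫ t in (0 : ℝ)..x, sinRoot z t * f t)) := by
    funext x
    rw [freeDer]
    ring
  rw [hDer]
  refine h.congr_ae (.of_forall fun x => ?_)
  simp only [freeSol]
  linear_combination -f x * cosRoot_sq_add z x

end FreeSolution

/-- The two Wronskians of a solution with the fundamental system are absolutely continuous with
derivatives `sinRoot z * f` and `-cosRoot z * f`, and they determine the solution. -/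
theorem eq_freeSol {z : ℂ} {f y y' : ℝ → ℂ} (hy : HasACDeriv y y')
    (hy' : HasACDeriv y' (fun x => -(f x + z * y x))) {x : ℝ} (hx : x ∈ Set.Icc 0 Real.pi) :
    y x = freeSol z (y 0) (y' 0) f x ∧ y' x = freeDer z (y 0) (y' 0) f x := by
  have hcos : HasACDeriv (fun x => cosRoot z x * y x + -1 * (sinRoot z x * y' x))
      (fun x => sinRoot z x * f x) :=
    (((hasACDeriv_cosRoot z).mul hy).add
      (((hasACDeriv_sinRoot z).mul hy').const_mul (-1))).congr_ae (.of_forall fun x => by ring)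
  have hsin : HasACDeriv (fun x => z * (sinRoot z x * y x) + cosRoot z x * y' x)
      (fun x => -(cosRoot z x * f x)) :=
    ((((hasACDeriv_sinRoot z).mul hy).const_mul z).add
      ((hasACDeriv_cosRoot z).mul hy')).congr_ae (.of_forall fun x => by ring)
  have ecos := hcos.2 x hx
  have esin := hsin.2 x hx
  simp only [intervalIntegral.integral_neg, cosRoot_zero_right, sinRoot_zero_right] at ecos esin
  constructor
  · rw [freeSol]
    linear_combination cosRoot z x * ecos + sinRoot z x * esin - y x * cosRoot_sq_add z x
  · rw [freeDer]
    linear_combination cosRoot z x * esin - z * sinRoot z x * ecos - y' x * cosRoot_sq_add z x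

/-- The gauge factor `exp (c x)`, which turns `d/dx + c` into `d/dx`. -/
def gauge (c : ℂ) (x : ℝ) : ℂ := Complex.exp (c * x)

theorem hasDerivAt_gauge (c : ℂ) (x : ℝ) : HasDerivAt (gauge c) (c * gauge c x) x :=
  ((Complex.hasDerivAt_exp _).comp x (hasDerivAt_const_mul_ofReal c x)).congr_deriv (mul_comm _ _)

@[fun_prop]
theorem continuous_gauge (c : ℂ) : Continuous (gauge c) :=
  continuous_iff_continuousAt.2 fun x => (hasDerivAt_gauge c x).continuousAt

@[simp] theorem gauge_zero_right (c : ℂ) : gauge c 0 = 1 := by simp [gauge]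

theorem gauge_neg_mul (c : ℂ) (x : ℝ) : gauge (-c) x * gauge c x = 1 := by
  rw [gauge, gauge, ← Complex.exp_add, neg_mul, neg_add_cancel, Complex.exp_zero]

theorem HasACDeriv.gauge_mul {f g : ℝ → ℂ} (c : ℂ) (h : HasACDeriv f g) :
    HasACDeriv (fun x => gauge c x * f x) (fun x => gauge c x * (g x + c * f x)) :=
  ((hasACDeriv_of_hasDerivAt (hasDerivAt_gauge c) (by fun_prop)).mul h).congr_ae
    (.of_forall fun x => by ring)

/-- The solution of `-𝓓²ψ - zψ = f`, where `𝓓 = d/dx + c`, with `ψ 0 = a` and `𝓓ψ 0 = b`. -/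
def edgeSol (c z a b : ℂ) (f : ℝ → ℂ) (x : ℝ) : ℂ :=
  gauge (-c) x * freeSol z a b (fun t => gauge c t * f t) x

/-- The quasiderivative `𝓓ψ` of `ψ = edgeSol c z a b f`. -/
def edgeDer (c z a b : ℂ) (f : ℝ → ℂ) (x : ℝ) : ℂ :=
  gauge (-c) x * freeDer z a b (fun t => gauge c t * f t) x

@[simp] theorem edgeSol_zero_right (c z a b : ℂ) (f : ℝ → ℂ) : edgeSol c z a b f 0 = a := by
  simp [edgeSol, freeSol]

@[simp] theorem edgeDer_zero_right (c z a b : ℂ) (f : ℝ → ℂ) : edgeDer c z a b f 0 = b := by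
  simp [edgeDer, freeDer]

section EdgeSolution

variable {c z : ℂ} {f : ℝ → ℂ}

theorem hasACDeriv_edgeSol (hf : IntervalIntegrable f volume 0 Real.pi) (a b : ℂ) :
    HasACDeriv (edgeSol c z a b f) (fun x => edgeDer c z a b f x - c * edgeSol c z a b f x) := by
  have hF := hf.continuousOn_mul (continuous_gauge c).continuousOn
  refine ((hasACDeriv_freeSol hF a b).gauge_mul (-c)).congr_ae (.of_forall fun x => ?_)
  simp only [edgeSol, edgeDer]
  ring

theorem hasACDeriv_edgeDer (hf : IntervalIntegrable f volume 0 Real.pi) (a b : ℂ) :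
    HasACDeriv (edgeDer c z a b f)
      (fun x => -(f x + z * edgeSol c z a b f x) - c * edgeDer c z a b f x) := by
  have hF := hf.continuousOn_mul (continuous_gauge c).continuousOn
  refine ((hasACDeriv_freeDer hF a b).gauge_mul (-c)).congr_ae (.of_forall fun x => ?_)
  simp only [edgeSol, edgeDer]
  linear_combination -f x * gauge_neg_mul c x

theorem eq_edgeSol {ψ η v : ℝ → ℂ} (hψ : HasACDeriv ψ (fun x => η x - c * ψ x))
    (hη : HasACDeriv η (fun x => -(v x) - c * η x))
    (hv : f =ᵐ[edgeMeasure] fun x => v x - z * ψ x) {x : ℝ} (hx : x ∈ Set.Icc 0 Real.pi) :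
    ψ x = edgeSol c z (ψ 0) (η 0) f x ∧ η x = edgeDer c z (ψ 0) (η 0) f x := by
  have hy : HasACDeriv (fun x => gauge c x * ψ x) (fun x => gauge c x * η x) :=
    (hψ.gauge_mul c).congr_ae (.of_forall fun x => by ring)
  have hy' : HasACDeriv (fun x => gauge c x * η x)
      (fun x => -(gauge c x * f x + z * (gauge c x * ψ x))) := by
    refine (hη.gauge_mul c).congr_ae ?_
    filter_upwards [hv] with x hx
    rw [hx]
    ring
  obtain ⟨e, e'⟩ := eq_freeSol hy hy' hx
  simp only [gauge_zero_right, one_mul] at e e'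
  constructor
  · rw [edgeSol, ← e, ← mul_assoc, gauge_neg_mul, one_mul]
  · rw [edgeDer, ← e', ← mul_assoc, gauge_neg_mul, one_mul]

end EdgeSolution

/-! ### The edge solution as an operator on the edge space -/

/-- `L²` of one edge. -/
abbrev EdgeL2 : Type := Lp ℂ 2 edgeMeasure

theorem intervalIntegrable_edgeL2 (f : EdgeL2) : IntervalIntegrable f volume 0 Real.pi := by
  rw [intervalIntegrable_iff_integrableOn_Icc_of_le Real.pi_pos.le]
  exact (Lp.memLp f).integrable (by norm_num)

theorem memLp_edgeMeasure_of_continuousOn {w : ℝ → ℂ} (hw : ContinuousOn w (Set.Icc 0 Real.pi)) :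
    MemLp w 2 edgeMeasure := by
  obtain ⟨B, hB⟩ := isCompact_Icc.exists_bound_of_continuousOn hw
  exact MemLp.of_bound (hw.aestronglyMeasurable measurableSet_Icc) B
    ((ae_restrict_mem measurableSet_Icc).mono hB)

theorem memLp_indicator_conj {w : ℝ → ℂ} (hw : Continuous w) (x : ℝ) :
    MemLp ((Set.Ioc 0 x).indicator fun t => starRingEnd ℂ (w t)) 2 edgeMeasure :=
  (memLp_edgeMeasure_of_continuousOn
    (Complex.continuous_conj.comp hw).continuousOn).indicator measurableSet_Ioc

/-- The functional `f ↦ ∫ w f` over the part `[0, x]` of the edge, as the inner product with the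
truncation of the conjugate of `w`. -/
def integralCLM (w : ℝ → ℂ) (hw : Continuous w) (x : ℝ) : EdgeL2 →L[ℂ] ℂ :=
  innerSL ℂ ((memLp_indicator_conj hw x).toLp : EdgeL2)

theorem integralCLM_apply {w : ℝ → ℂ} (hw : Continuous w) {x : ℝ} (hx : x ∈ Set.Icc 0 Real.pi)
    (f : EdgeL2) : integralCLM w hw x f = ∫ t in (0 : ℝ)..x, w t * f t := by
  have hsub : Set.Ioc 0 x ⊆ Set.Icc 0 Real.pi :=
    Set.Ioc_subset_Icc_self.trans (Set.Icc_subset_Icc_right hx.2)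
  have hinner : integralCLM w hw x f =
      ∫ t, (Set.Ioc 0 x).indicator (fun t => w t * f t) t ∂edgeMeasure := by
    refine (L2.inner_def (𝕜 := ℂ) _ f).trans (integral_congr_ae ?_)
    filter_upwards [(memLp_indicator_conj hw x).coeFn_toLp] with t ht
    rw [ht]
    by_cases htx : t ∈ Set.Ioc 0 x <;> simp [htx, mul_comm]
  rw [hinner, integral_indicator measurableSet_Ioc, Measure.restrict_restrict_of_subset hsub,
    intervalIntegral.integral_of_le hx.1]

theorem integralCLM_pi_ne_zero {w : ℝ → ℂ} (hw : Continuous w) {x : ℝ}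
    (hx : x ∈ Set.Icc 0 Real.pi) (hwx : w x ≠ 0) : integralCLM w hw Real.pi ≠ 0 := by
  intro hzero
  have hlp : ((memLp_indicator_conj hw Real.pi).toLp : EdgeL2) = 0 := by
    rw [← inner_self_eq_zero (𝕜 := ℂ)]
    exact DFunLike.congr_fun hzero _
  have hIoc : ∀ᵐ t ∂edgeMeasure, t ∈ Set.Ioc 0 Real.pi := by
    rw [edgeMeasure, ← restrict_Ioc_eq_restrict_Icc]
    exact ae_restrict_mem measurableSet_Ioc
  have hae : w =ᵐ[volume.restrict (Set.Icc 0 Real.pi)] 0 := by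
    rw [Lp.eq_zero_iff_ae_eq_zero] at hlp
    filter_upwards [hlp, (memLp_indicator_conj hw Real.pi).coeFn_toLp, hIoc] with t h0 h ht
    rw [h, Set.indicator_of_mem ht] at h0
    exact (map_eq_zero _).1 h0
  exact hwx (Measure.eqOn_Icc_of_ae_eq volume Real.pi_pos.ne hae hw.continuousOn
    continuousOn_const hx)

section PointwiseOperator

variable {V : Type*} [NormedAddCommGroup V] [NormedSpace ℂ V] [CompleteSpace V]

theorem exists_norm_apply_le_of_continuousOn {Φ : ℝ → V →L[ℂ] ℂ}
    (hΦ : ∀ v, ContinuousOn (fun x => Φ x v) (Set.Icc 0 Real.pi)) :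
    ∃ C, 0 ≤ C ∧ ∀ x ∈ Set.Icc 0 Real.pi, ∀ v, ‖Φ x v‖ ≤ C * ‖v‖ := by
  obtain ⟨C, hC⟩ := banach_steinhaus (g := fun x : Set.Icc 0 Real.pi => Φ x) fun v => by
    obtain ⟨B, hB⟩ := isCompact_Icc.exists_bound_of_continuousOn (hΦ v)
    exact ⟨B, fun x => hB x x.2⟩
  have hC0 : 0 ≤ C := (norm_nonneg _).trans (hC ⟨0, le_rfl, Real.pi_pos.le⟩)
  exact ⟨C, hC0, fun x hx v => (Φ x).le_of_opNorm_le (hC ⟨x, hx⟩) v⟩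

/-- The operator into the edge space with the given point evaluations. -/
def ofPointEval (Φ : ℝ → V →L[ℂ] ℂ)
    (hΦ : ∀ v, ContinuousOn (fun x => Φ x v) (Set.Icc 0 Real.pi)) : V →L[ℂ] EdgeL2 :=
  LinearMap.mkContinuousOfExistsBound
    { toFun v := (memLp_edgeMeasure_of_continuousOn (hΦ v)).toLp
      map_add' v w := by
        rw [← MemLp.toLp_add]
        exact MemLp.toLp_congr _ _ (.of_forall fun x => map_add (Φ x) v w)
      map_smul' k v := by
        rw [RingHom.id_apply, ← MemLp.toLp_const_smul]
        exact MemLp.toLp_congr _ _ (.of_forall fun x => map_smul (Φ x) k v) }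
    (by
      obtain ⟨C, hC0, hC⟩ := exists_norm_apply_le_of_continuousOn hΦ
      refine ⟨(measureUnivNNReal edgeMeasure : ℝ) ^ (2 : ENNReal).toReal⁻¹ * C, fun v => ?_⟩
      rw [mul_assoc]
      refine Lp.norm_le_of_ae_bound (by positivity) ?_
      filter_upwards [MemLp.coeFn_toLp (memLp_edgeMeasure_of_continuousOn (hΦ v)),
        ae_restrict_mem measurableSet_Icc] with x hv hx
      exact (congrArg norm hv).trans_le (hC x hx v))

theorem coeFn_ofPointEval {Φ : ℝ → V →L[ℂ] ℂ}
    (hΦ : ∀ v, ContinuousOn (fun x => Φ x v) (Set.Icc 0 Real.pi)) (v : V) :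
    (ofPointEval Φ hΦ v : ℝ → ℂ) =ᵐ[edgeMeasure] fun x => Φ x v :=
  MemLp.coeFn_toLp (memLp_edgeMeasure_of_continuousOn (hΦ v))

end PointwiseOperator

/-- The functional `f ↦ ∫ exp (c t) cos (√z t) f t` over `[0, x]`. -/
def cosFun (c z : ℂ) (x : ℝ) : EdgeL2 →L[ℂ] ℂ :=
  integralCLM (fun t => cosRoot z t * gauge c t) (by fun_prop) x

/-- The functional `f ↦ ∫ exp (c t) sin (√z t) / √z f t` over `[0, x]`. -/
def sinFun (c z : ℂ) (x : ℝ) : EdgeL2 →L[ℂ] ℂ :=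
  integralCLM (fun t => sinRoot z t * gauge c t) (by fun_prop) x

theorem zero_mem_Icc_pi : (0 : ℝ) ∈ Set.Icc 0 Real.pi := ⟨le_rfl, Real.pi_pos.le⟩

theorem pi_mem_Icc_pi : Real.pi ∈ Set.Icc 0 Real.pi := ⟨Real.pi_pos.le, le_rfl⟩

theorem edgeSol_eq (c z a b : ℂ) (f : EdgeL2) {x : ℝ} (hx : x ∈ Set.Icc 0 Real.pi) :
    edgeSol c z a b f x = gauge (-c) x *
      (sinRoot z x * (b - cosFun c z x f) + cosRoot z x * (a + sinFun c z x f)) := by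
  simp only [edgeSol, freeSol, cosFun, sinFun, integralCLM_apply _ hx, mul_assoc]

theorem edgeDer_eq (c z a b : ℂ) (f : EdgeL2) {x : ℝ} (hx : x ∈ Set.Icc 0 Real.pi) :
    edgeDer c z a b f x = gauge (-c) x *
      (cosRoot z x * (b - cosFun c z x f) - z * sinRoot z x * (a + sinFun c z x f)) := by
  simp only [edgeDer, freeDer, cosFun, sinFun, integralCLM_apply _ hx, mul_assoc]

/-- The value at `x` of the edge solution, as a functional of the initial values and the
right-hand side. -/
def edgeEval (c z : ℂ) (x : ℝ) : (ℂ × ℂ × EdgeL2) →L[ℂ] ℂ :=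
  let value := ContinuousLinearMap.fst ℂ ℂ (ℂ × EdgeL2)
  let slope := ContinuousLinearMap.fst ℂ ℂ EdgeL2 ∘L ContinuousLinearMap.snd ℂ ℂ (ℂ × EdgeL2)
  let source := ContinuousLinearMap.snd ℂ ℂ EdgeL2 ∘L ContinuousLinearMap.snd ℂ ℂ (ℂ × EdgeL2)
  gauge (-c) x • (sinRoot z x • (slope - cosFun c z x ∘L source) +
    cosRoot z x • (value + sinFun c z x ∘L source))

theorem edgeEval_apply (c z : ℂ) (p : ℂ × ℂ × EdgeL2) {x : ℝ} (hx : x ∈ Set.Icc 0 Real.pi) :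
    edgeEval c z x p = edgeSol c z p.1 p.2.1 p.2.2 x :=
  (edgeSol_eq c z p.1 p.2.1 p.2.2 hx).symm

theorem continuousOn_edgeEval (c z : ℂ) (p : ℂ × ℂ × EdgeL2) :
    ContinuousOn (fun x => edgeEval c z x p) (Set.Icc 0 Real.pi) :=
  (hasACDeriv_edgeSol (intervalIntegrable_edgeL2 p.2.2) p.1 p.2.1).continuousOn.congr
    fun _ hx => edgeEval_apply c z p hx

/-- The edge solution as an operator of the initial values and the right-hand side. -/
def edgeCLM (c z : ℂ) : (ℂ × ℂ × EdgeL2) →L[ℂ] EdgeL2 :=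
  ofPointEval (edgeEval c z) (continuousOn_edgeEval c z)

theorem coeFn_edgeCLM (c z a b : ℂ) (f : EdgeL2) :
    (edgeCLM c z (a, b, f) : ℝ → ℂ) =ᵐ[edgeMeasure] edgeSol c z a b f := by
  filter_upwards [coeFn_ofPointEval (continuousOn_edgeEval c z) (a, b, f),
    ae_restrict_mem measurableSet_Icc] with x h hx
  exact h.trans (edgeEval_apply c z (a, b, f) hx)

theorem eq_zero_of_edgeCLM_eq_zero {c z a b : ℂ} (h : edgeCLM c z (a, b, 0) = 0) :
    a = 0 ∧ b = 0 := by
  have hi := intervalIntegrable_edgeL2 0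
  have hsol : edgeSol c z a b (0 : EdgeL2) =ᵐ[edgeMeasure] 0 := by
    filter_upwards [coeFn_edgeCLM c z a b 0, Lp.coeFn_zero ℂ 2 edgeMeasure] with x h1 h2
    rw [← h1, h]
    exact h2
  have hder : edgeDer c z a b (0 : EdgeL2) =ᵐ[edgeMeasure] 0 := by
    filter_upwards [(hasACDeriv_edgeSol hi a b).eq_zero hsol, hsol] with x h1 h2
    simp only [Pi.zero_apply] at h1 h2 ⊢
    linear_combination h1 + c * h2
  exact ⟨by simpa using (hasACDeriv_edgeSol hi a b).eqOn_zero hsol zero_mem_Icc_pi,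
    by simpa using (hasACDeriv_edgeDer hi a b).eqOn_zero hder zero_mem_Icc_pi⟩

theorem exists_norm_le_edgeCLM (c z : ℂ) :
    ∃ K : ℝ, 0 ≤ K ∧ ∀ (a b : ℂ) (f : EdgeL2),
      ‖a‖ ≤ K * (‖edgeCLM c z (a, b, f)‖ + ‖f‖) := by
  set L : (ℂ × ℂ) →ₗ[ℂ] EdgeL2 :=
    { toFun p := edgeCLM c z (p.1, p.2, 0)
      map_add' p q := by rw [← map_add]; simp
      map_smul' k p := by rw [RingHom.id_apply, ← map_smul]; simp } with hL
  have hinj : Function.Injective L := (injective_iff_map_eq_zero L).2 fun p hp =>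
    Prod.ext_iff.2 (eq_zero_of_edgeCLM_eq_zero hp)
  obtain ⟨K, -, hK⟩ := L.injective_iff_antilipschitz.1 hinj
  set N : EdgeL2 →L[ℂ] EdgeL2 :=
    edgeCLM c z ∘L (ContinuousLinearMap.inr ℂ ℂ (ℂ × EdgeL2)) ∘L
      (ContinuousLinearMap.inr ℂ ℂ EdgeL2) with hN
  have hsplit (a b : ℂ) (f : EdgeL2) : L (a, b) = edgeCLM c z (a, b, f) - N f := by
    simp [hL, hN, ← map_sub]
  refine ⟨K * (1 + ‖N‖), by positivity, fun a b f => ?_⟩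
  calc ‖a‖ ≤ ‖(a, b)‖ := norm_fst_le (a, b)
    _ ≤ K * ‖L (a, b)‖ := hK.le_mul_norm (map_zero L) (a, b)
    _ ≤ K * (‖edgeCLM c z (a, b, f)‖ + ‖N‖ * ‖f‖) := by
        rw [hsplit a b f]
        gcongr
        exact (norm_sub_le _ _).trans (by gcongr; exact N.le_opNorm f)
    _ ≤ K * ((1 + ‖N‖) * (‖edgeCLM c z (a, b, f)‖ + ‖f‖)) := by
        gcongr
        nlinarith [norm_nonneg f, mul_nonneg (norm_nonneg N)
          (norm_nonneg (edgeCLM c z (a, b, f)))]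
    _ = K * (1 + ‖N‖) * (‖edgeCLM c z (a, b, f)‖ + ‖f‖) := (mul_assoc _ _ _).symm

/-! ### The resolvent equation on the chain -/

/-- The values `a e` and quasiderivatives `b e` at the left ends of the edges match at the
vertices when every edge carries the corresponding solution of `-𝓓²ψ - zψ = f`. -/
structure IsVertexData (A : ℝ) (α : ℤ → ℝ) (z : ℂ) (f : L2Chain) (a b : Edge → ℂ) : Prop where
  left_eq : ∀ j s, a (j, s) = a (j, true)
  right_eq : ∀ j s, edgeSol (quasiCoeff A s) z (a (j - 1, s)) (b (j - 1, s)) (f (j - 1, s))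
    Real.pi = a (j, true)
  coupling : ∀ j, ∑ s, (b (j, s) - edgeDer (quasiCoeff A s) z (a (j - 1, s)) (b (j - 1, s))
    (f (j - 1, s)) Real.pi) = α j * a (j, true)

theorem coeFn_add_smul (z : ℂ) (u f : L2Chain) (e : Edge) :
    ((f + z • u : L2Chain) e : ℝ → ℂ) =ᵐ[edgeMeasure] fun x => f e x + z * u e x := by
  filter_upwards [Lp.coeFn_add (f e) (z • u e), Lp.coeFn_smul z (u e)] with x hadd hsmul
  change ((f e + z • u e : EdgeL2) : ℝ → ℂ) x = _
  rw [hadd, Pi.add_apply, hsmul, Pi.smul_apply, smul_eq_mul]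

section ResolventEquation

variable {A : ℝ} {α : ℤ → ℝ} {z : ℂ} {u f : L2Chain}

theorem exists_isVertexData_of_mem_hamiltonianGraph (h : (u, f + z • u) ∈ hamiltonianGraph A α) :
    ∃ a b, IsVertexData A α z f a b ∧
      ∀ e, u e = edgeCLM (quasiCoeff A e.2) z (a e, b e, f e) := by
  obtain ⟨ψ, η, hu, h⟩ := h
  have hsol (e : Edge) (x : ℝ) (hx : x ∈ Set.Icc 0 Real.pi) :
      ψ e x = edgeSol (quasiCoeff A e.2) z (ψ e 0) (η e 0) (f e) x ∧
        η e x = edgeDer (quasiCoeff A e.2) z (ψ e 0) (η e 0) (f e) x := by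
    refine eq_edgeSol (h.deriv_fst e) (h.deriv_snd e) ?_ hx
    filter_upwards [coeFn_add_smul z u f e, hu e] with y hv hψ
    rw [hv, ← hψ, add_sub_cancel_right]
  refine ⟨fun e => ψ e 0, fun e => η e 0, ⟨?_, fun j s => ?_, fun j => ?_⟩, fun e => Lp.ext ?_⟩
  · rintro j (_ | _)
    exacts [h.lower_eq j, rfl]
  · rw [← (hsol (j - 1, s) Real.pi pi_mem_Icc_pi).1]
    cases s
    exacts [h.lower_left_eq j, h.upper_left_eq j]
  · simp only [Fintype.sum_bool, ← (hsol (j - 1, _) Real.pi pi_mem_Icc_pi).2]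
    linear_combination h.coupling j
  · filter_upwards [hu e, coeFn_edgeCLM (quasiCoeff A e.2) z (ψ e 0) (η e 0) (f e),
      ae_restrict_mem measurableSet_Icc] with x hψ hedge hx
    rw [hedge, ← (hsol e x hx).1]
    exact hψ

theorem IsVertexData.mem_hamiltonianGraph {a b : Edge → ℂ} (h : IsVertexData A α z f a b)
    (hu : ∀ e, u e = edgeCLM (quasiCoeff A e.2) z (a e, b e, f e)) :
    (u, f + z • u) ∈ hamiltonianGraph A α := by
  have hsol (e : Edge) :
      (u e : ℝ → ℂ) =ᵐ[edgeMeasure] edgeSol (quasiCoeff A e.2) z (a e) (b e) (f e) := by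
    rw [hu e]
    exact coeFn_edgeCLM _ _ _ _ _
  refine ⟨fun e => edgeSol (quasiCoeff A e.2) z (a e) (b e) (f e),
    fun e => edgeDer (quasiCoeff A e.2) z (a e) (b e) (f e), hsol,
    fun e => hasACDeriv_edgeSol (intervalIntegrable_edgeL2 (f e)) _ _,
    fun e => (hasACDeriv_edgeDer (intervalIntegrable_edgeL2 (f e)) _ _).congr_ae ?_,
    fun j => ?_, fun j => ?_, fun j => ?_, fun j => ?_⟩
  · filter_upwards [coeFn_add_smul z u f e, hsol e] with x hv hψ
    rw [hv, hψ]
  · simpa only [edgeSol_zero_right] using h.left_eq j false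
  · simpa only [edgeSol_zero_right] using h.right_eq j true
  · simpa only [edgeSol_zero_right] using h.right_eq j false
  · have hj := h.coupling j
    simp only [Fintype.sum_bool] at hj
    simp only [edgeSol_zero_right, edgeDer_zero_right]
    linear_combination hj

end ResolventEquation

/-! ### Reduction to a difference equation for the vertex values -/

/-- The value `exp (± i A π)` at the right end of an edge of the gauge factor of an integer
potential. -/
def magSign (A : ℤ) : ℂ := (-1) ^ A

theorem magSign_mul_self (A : ℤ) : magSign A * magSign A = 1 := by
  rw [magSign, ← mul_zpow, neg_one_mul, neg_neg, one_zpow]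

theorem magSign_eq_or (A : ℤ) : magSign A = 1 ∨ magSign A = -1 :=
  mul_self_eq_one_iff.1 (magSign_mul_self A)

theorem gauge_neg_quasiCoeff_pi (A : ℤ) (s : Bool) :
    gauge (-quasiCoeff A s) Real.pi = magSign A := by
  cases s
  · have hexp : -quasiCoeff A false * Real.pi = (A : ℂ) * (Real.pi * Complex.I) := by
      simp only [quasiCoeff, Complex.ofReal_intCast, Bool.false_eq_true, if_false]
      ring
    rw [gauge, hexp, Complex.exp_int_mul, Complex.exp_pi_mul_I, magSign]
  · have hexp : -quasiCoeff A true * Real.pi = ((-A : ℤ) : ℂ) * (Real.pi * Complex.I) := by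
      simp only [quasiCoeff, Complex.ofReal_intCast, if_true, Int.cast_neg]
      ring
    rw [gauge, hexp, Complex.exp_int_mul, Complex.exp_pi_mul_I, zpow_neg, ← inv_zpow, inv_neg_one,
      magSign]

/-- The initial slope of the edge solution with end values `a` and `a'` and right-hand side
`f`. -/
def initSlope (A : ℤ) (z : ℂ) (s : Bool) (a a' : ℂ) (f : EdgeL2) : ℂ :=
  cosFun (quasiCoeff A s) z Real.pi f + (magSign A * a' -
    cosRoot z Real.pi * (a + sinFun (quasiCoeff A s) z Real.pi f)) / sinRoot z Real.pi

/-- The functional `f ↦ ∫ exp (c t) sin (√z (π - t)) / √z f t` over the edge. -/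
def sinRevFun (c z : ℂ) : EdgeL2 →L[ℂ] ℂ :=
  sinRoot z Real.pi • cosFun c z Real.pi - cosRoot z Real.pi • sinFun c z Real.pi

/-- The right-hand side of the difference equation for the vertex values. -/
def vertexSource (A : ℤ) (z : ℂ) (f : L2Chain) (j : ℤ) : ℂ :=
  -(magSign A / 2) * ∑ s, sinRevFun (quasiCoeff A s) z (f (j, s)) +
    -(1 / 2) * ∑ s, sinFun (quasiCoeff A s) z Real.pi (f (j - 1, s))

section VertexEquation

variable {A : ℤ} {z : ℂ} (hz : sinRoot z Real.pi ≠ 0)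
include hz

theorem edgeSol_pi_eq_iff {s : Bool} {a a' b : ℂ} {g : EdgeL2} :
    edgeSol (quasiCoeff A s) z a b g Real.pi = a' ↔ b = initSlope A z s a a' g := by
  have hsign := magSign_mul_self A
  rw [edgeSol_eq _ _ _ _ _ pi_mem_Icc_pi, gauge_neg_quasiCoeff_pi, initSlope]
  constructor
  · rintro rfl
    field_simp
    linear_combination -(sinRoot z Real.pi * (b - cosFun (quasiCoeff A s) z Real.pi g) +
      cosRoot z Real.pi * (a + sinFun (quasiCoeff A s) z Real.pi g)) * hsign
  · rintro rfl
    field_simp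
    linear_combination a' * hsign

theorem edgeDer_initSlope_pi (s : Bool) (a a' : ℂ) (g : EdgeL2) :
    edgeDer (quasiCoeff A s) z a (initSlope A z s a a' g) g Real.pi =
      (cosRoot z Real.pi * a' - magSign A * (a + sinFun (quasiCoeff A s) z Real.pi g)) /
        sinRoot z Real.pi := by
  rw [edgeDer_eq _ _ _ _ _ pi_mem_Icc_pi, gauge_neg_quasiCoeff_pi, initSlope]
  field_simp
  linear_combination cosRoot z Real.pi * a' * magSign_mul_self A -
    magSign A * (a + sinFun (quasiCoeff A s) z Real.pi g) * cosRoot_sq_add z Real.pi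

theorem coupling_iff_vertexEquation (w : ℂ) (f : L2Chain) (a : ℤ → ℂ) (j : ℤ) :
    ∑ s, (initSlope A z s (a j) (a (j + 1)) (f (j, s)) - edgeDer (quasiCoeff A s) z (a (j - 1))
      (initSlope A z s (a (j - 1)) (a j) (f (j - 1, s))) (f (j - 1, s)) Real.pi) = w * a j ↔
    a (j + 1) + a (j - 1) - magSign A * (2 * cosRoot z Real.pi + w * sinRoot z Real.pi / 2) * a j =
      vertexSource A z f j := by
  have hsign := magSign_mul_self A
  have hfactor : 2 * magSign A / sinRoot z Real.pi ≠ 0 :=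
    div_ne_zero (mul_ne_zero two_ne_zero (left_ne_zero_of_mul_eq_one hsign)) hz
  rw [← sub_eq_zero, ← sub_eq_zero (b := vertexSource A z f j)]
  refine (Eq.congr_left ?_).trans (mul_eq_zero_iff_left hfactor)
  simp only [edgeDer_initSlope_pi hz]
  simp only [initSlope, vertexSource, sinRevFun, Fintype.sum_bool, sub_apply, smul_apply,
    smul_eq_mul]
  field_simp
  linear_combination (w * sinRoot z Real.pi * a j + 4 * cosRoot z Real.pi * a j -
    (sinRoot z Real.pi * (cosFun (quasiCoeff A true) z Real.pi (f (j, true)) +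
        cosFun (quasiCoeff A false) z Real.pi (f (j, false))) -
      cosRoot z Real.pi * (sinFun (quasiCoeff A true) z Real.pi (f (j, true)) +
        sinFun (quasiCoeff A false) z Real.pi (f (j, false))))) * hsign

end VertexEquation

theorem mem_hamiltonianGraph_iff {A : ℤ} {α : ℤ → ℝ} {z : ℂ} (hz : sinRoot z Real.pi ≠ 0)
    (u f : L2Chain) :
    (u, f + z • u) ∈ hamiltonianGraph A α ↔ ∃ a : ℤ → ℂ,
      (∀ e : Edge, u e = edgeCLM (quasiCoeff A e.2) z
        (a e.1, initSlope A z e.2 (a e.1) (a (e.1 + 1)) (f e), f e)) ∧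
      ∀ j, a (j + 1) + a (j - 1) -
        magSign A * (2 * cosRoot z Real.pi + α j * sinRoot z Real.pi / 2) * a j =
          vertexSource A z f j := by
  constructor
  · intro h
    obtain ⟨a, b, hab, hu⟩ := exists_isVertexData_of_mem_hamiltonianGraph h
    have hb (j : ℤ) (s : Bool) :
        b (j, s) = initSlope A z s (a (j, true)) (a (j + 1, true)) (f (j, s)) := by
      rw [← hab.left_eq j s, ← edgeSol_pi_eq_iff hz]
      simpa only [add_sub_cancel_right] using hab.right_eq (j + 1) s
    refine ⟨fun j => a (j, true), fun ⟨j, s⟩ => ?_, fun j => ?_⟩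
    · rw [hu (j, s), hab.left_eq j s, hb j s]
    · have hj := hab.coupling j
      simp only [hb, hab.left_eq (j - 1), sub_add_cancel] at hj
      exact (coupling_iff_vertexEquation hz _ f (fun j => a (j, true)) j).1 hj
  · rintro ⟨a, hu, ha⟩
    refine IsVertexData.mem_hamiltonianGraph ⟨fun _ _ => rfl, fun j s => ?_, fun j => ?_⟩ hu
    · simp only [edgeSol_pi_eq_iff hz, sub_add_cancel]
    · simpa only [sub_add_cancel] using (coupling_iff_vertexEquation hz _ f a j).2 (ha j)

/-! ### Difference operators on square summable sequences -/

section Pull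

variable {ι ι' X : Type*} [NormedAddCommGroup X]

theorem sum_norm_indicator_comp_le {τ : ι → ι'} {s : Set ι} (hτ : Set.InjOn τ s)
    (f : lp (fun _ : ι' => X) 2) (t : Finset ι) :
    ∑ i ∈ t, ‖s.indicator (fun i => f (τ i)) i‖ ^ (2 : ENNReal).toReal ≤
      ‖f‖ ^ (2 : ENNReal).toReal := by
  classical
  calc ∑ i ∈ t, ‖s.indicator (fun i => f (τ i)) i‖ ^ (2 : ENNReal).toReal
      = ∑ i ∈ t with i ∈ s, ‖f (τ i)‖ ^ (2 : ENNReal).toReal := by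
        rw [Finset.sum_filter]
        refine Finset.sum_congr rfl fun i _ => ?_
        by_cases hi : i ∈ s <;> simp [hi]
    _ = ∑ k ∈ (t.filter (· ∈ s)).image τ, ‖f k‖ ^ (2 : ENNReal).toReal :=
        (Finset.sum_image (f := fun k => ‖f k‖ ^ (2 : ENNReal).toReal) fun i hi k hk =>
          hτ (Finset.mem_filter.1 hi).2 (Finset.mem_filter.1 hk).2).symm
    _ ≤ ‖f‖ ^ (2 : ENNReal).toReal := lp.sum_rpow_le_norm_rpow (by norm_num) f _

variable [NormedSpace ℂ X]

/-- Reindexing of square summable families along a map that is injective on `s`, with zero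
outside of `s`. -/
def lpPull (τ : ι → ι') (s : Set ι) (hτ : Set.InjOn τ s) :
    lp (fun _ : ι' => X) 2 →L[ℂ] lp (fun _ : ι => X) 2 :=
  LinearMap.mkContinuous
    { toFun f := ⟨s.indicator fun i => f (τ i), memℓp_gen' (sum_norm_indicator_comp_le hτ f)⟩
      map_add' f g := lp.ext (s.indicator_add (fun i => f (τ i)) fun i => g (τ i))
      map_smul' k f := lp.ext (s.indicator_const_smul k fun i => f (τ i)) }
    1 fun f => by
      rw [one_mul]
      exact lp.norm_le_of_forall_sum_le (by norm_num) (norm_nonneg _)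
        (sum_norm_indicator_comp_le hτ f)

theorem lpPull_apply (τ : ι → ι') (s : Set ι) (hτ : Set.InjOn τ s) (f : lp (fun _ : ι' => X) 2)
    (i : ι) : lpPull τ s hτ f i = s.indicator (fun i => f (τ i)) i := rfl

theorem norm_lpPull_le (τ : ι → ι') (s : Set ι) (hτ : Set.InjOn τ s) :
    ‖lpPull (X := X) τ s hτ‖ ≤ 1 :=
  LinearMap.mkContinuous_norm_le _ zero_le_one _

end Pull

/-- The space of square summable vertex values. -/
abbrev VertexL2 : Type := lp (fun _ : ℤ => ℂ) 2

/-- Translation of sequences: `(shift m a) j = a (j + m)`. -/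
def shift (m : ℤ) : VertexL2 →L[ℂ] VertexL2 :=
  lpPull (· + m) Set.univ (add_left_injective m).injOn

@[simp] theorem shift_apply (m : ℤ) (a : VertexL2) (j : ℤ) : shift m a j = a (j + m) := by
  rw [shift, lpPull_apply, Set.indicator_univ]

theorem norm_shift_le (m : ℤ) : ‖shift m‖ ≤ 1 := norm_lpPull_le _ _ _

/-- The difference operator `a ↦ (a (j + 1) + a (j - 1) - β a j - d δ_{j1} a j)_j`. -/
def vertexOp (β d : ℂ) : VertexL2 →L[ℂ] VertexL2 :=
  shift 1 + shift (-1) - β • 1 -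
    (lp.evalCLM ℂ (fun _ : ℤ => ℂ) 2 1).smulRight (lp.single 2 1 d)

theorem vertexOp_apply (β d : ℂ) (a : VertexL2) (j : ℤ) :
    vertexOp β d a j = a (j + 1) + a (j - 1) - β * a j - if j = 1 then d * a j else 0 := by
  have happly : vertexOp β d a j =
    shift 1 a j + shift (-1) a j - β * a j - a 1 * (lp.single 2 1 d : VertexL2) j := rfl
  rw [happly, shift_apply, shift_apply, lp.single_apply, ← sub_eq_add_neg]
  split_ifs with hj
  · rw [hj, Pi.single_eq_same, mul_comm d]
  · rw [Pi.single_eq_of_ne hj, mul_zero]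

theorem isUnit_one_sub_smul_shift {l : ℂ} (hl : ‖l‖ < 1) (m : ℤ) : IsUnit (1 - l • shift m) := by
  refine isUnit_one_sub_of_norm_lt_one ?_
  rw [norm_smul]
  exact (mul_le_of_le_one_right (norm_nonneg l) (norm_shift_le m)).trans_lt hl

theorem isUnit_vertexOp_zero {l : ℂ} (h0 : l ≠ 0) (h1 : ‖l‖ < 1) :
    IsUnit (vertexOp (l + l⁻¹) 0) := by
  have hfactor : vertexOp (l + l⁻¹) 0 =
      (-l⁻¹) • ((1 - l • shift (-1)) * (1 - l • shift 1)) := by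
    ext a j
    change vertexOp (l + l⁻¹) 0 a j =
      -l⁻¹ * (a j - l * shift 1 a j - l * shift (-1) (a - l • shift 1 a) j)
    rw [vertexOp_apply]
    simp only [lp.coeFn_sub, lp.coeFn_smul, Pi.sub_apply, Pi.smul_apply, smul_eq_mul, shift_apply,
      sub_add_cancel, zero_mul, ite_self, sub_zero, ← sub_eq_add_neg]
    field_simp
    ring
  rw [hfactor]
  exact ((isUnit_one_sub_smul_shift h1 _).mul (isUnit_one_sub_smul_shift h1 _)).smul
    (Units.mk0 (-l⁻¹) (neg_ne_zero.2 (inv_ne_zero h0)))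

theorem isUnit_sub_smulRight {𝕜 E : Type*} [NontriviallyNormedField 𝕜] [NormedAddCommGroup E]
    [NormedSpace 𝕜 E] [CompleteSpace E] {T : E →L[𝕜] E} (hT : IsUnit T) {φ : E →L[𝕜] 𝕜} {v : E}
    (hinj : Function.Injective (T - φ.smulRight v)) : IsUnit (T - φ.smulRight v) := by
  have happly (x : E) : (T - φ.smulRight v) x = T x - φ x • v := rfl
  obtain ⟨-, hsurj⟩ := ContinuousLinearMap.isUnit_iff_bijective.1 hT
  obtain ⟨g, hg⟩ := hsurj v
  refine ContinuousLinearMap.isUnit_iff_bijective.2 ⟨hinj, fun y => ?_⟩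
  obtain ⟨x, hx⟩ := hsurj y
  by_cases hφ : 1 - φ g = 0
  · have hg0 : g = 0 := by
      refine (injective_iff_map_eq_zero _).1 hinj g ?_
      rw [happly, hg, ← sub_eq_zero.1 hφ, one_smul, sub_self]
    rw [hg0, map_zero, sub_zero] at hφ
    exact absurd hφ one_ne_zero
  · refine ⟨x + (φ x / (1 - φ g)) • g, ?_⟩
    have hcoeff : φ x / (1 - φ g) - φ (x + (φ x / (1 - φ g)) • g) = 0 := by
      rw [map_add, map_smul, smul_eq_mul]
      field_simp
      ring
    rw [happly, map_add, map_smul, hx, hg, add_sub_assoc, ← sub_smul, hcoeff, zero_smul, add_zero]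

theorem isUnit_vertexOp {l : ℂ} (h0 : l ≠ 0) (h1 : ‖l‖ < 1) {d : ℂ}
    (hker : ∀ a, vertexOp (l + l⁻¹) d a = 0 → a = 0) : IsUnit (vertexOp (l + l⁻¹) d) := by
  have hsplit : vertexOp (l + l⁻¹) d = vertexOp (l + l⁻¹) 0 -
      (lp.evalCLM ℂ (fun _ : ℤ => ℂ) 2 1).smulRight (lp.single 2 1 d) := by
    have hzero : (lp.single 2 1 0 : VertexL2) = 0 := lp.single_zero _ _
    simp only [vertexOp, hzero, ContinuousLinearMap.smulRight_zero, sub_zero]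
  have hinj := (injective_iff_map_eq_zero _).2 hker
  rw [hsplit] at hinj ⊢
  exact isUnit_sub_smulRight (isUnit_vertexOp_zero h0 h1) hinj

theorem exists_norm_eq_one_add_inv_eq {r : ℝ} (hr : r ∈ Set.Icc (-1) 1) :
    ∃ l : ℂ, ‖l‖ = 1 ∧ l + l⁻¹ = 2 * r := by
  refine ⟨Complex.exp (Real.arccos r * Complex.I), Complex.norm_exp_ofReal_mul_I _, ?_⟩
  rw [← Complex.exp_neg, ← neg_mul, ← Complex.two_cos, ← Complex.ofReal_cos,
    Real.cos_arccos hr.1 hr.2]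

theorem exists_norm_lt_one_add_inv_eq {β : ℂ} (hβ : ∀ r ∈ Set.Icc (-1 : ℝ) 1, β ≠ 2 * r) :
    ∃ l : ℂ, l ≠ 0 ∧ ‖l‖ < 1 ∧ l + l⁻¹ = β := by
  obtain ⟨w, hw⟩ : ∃ w : ℂ, w ^ 2 = β ^ 2 / 4 - 1 := ⟨_, csqrt_sq _⟩
  have hprod : (β / 2 + w) * (β / 2 - w) = 1 := by linear_combination -hw
  obtain ⟨l, h0, hsum⟩ : ∃ l : ℂ, l ≠ 0 ∧ l + l⁻¹ = β := by
    refine ⟨β / 2 + w, left_ne_zero_of_mul_eq_one hprod, ?_⟩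
    rw [inv_eq_of_mul_eq_one_right hprod]
    ring
  rcases lt_trichotomy ‖l‖ 1 with hl | hl | hl
  · exact ⟨l, h0, hl, hsum⟩
  · refine absurd ?_ (hβ l.re (abs_le.1 (hl ▸ Complex.abs_re_le_norm l)))
    rw [← hsum, Complex.inv_eq_conj hl, Complex.add_conj]
    push_cast
    ring
  · refine ⟨l⁻¹, inv_ne_zero h0, ?_, ?_⟩
    · rw [norm_inv]
      exact inv_lt_one_of_one_lt₀ hl
    · rw [inv_inv, add_comm, hsum]

theorem eq_pow_mul_of_tendsto_zero {l : ℂ} (h0 : l ≠ 0) (h1 : ‖l‖ ≤ 1) {x : ℕ → ℂ}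
    (hx : ∀ n, x (n + 2) + x n = (l + l⁻¹) * x (n + 1)) (ht : Tendsto x atTop (𝓝 0)) (n : ℕ) :
    x n = l ^ n * x 0 := by
  have hdefect (n : ℕ) : x (n + 1) - l * x n = (l⁻¹) ^ n * (x 1 - l * x 0) := by
    induction n with
    | zero => rw [pow_zero, one_mul]
    | succ n ih =>
      rw [pow_succ', mul_assoc, ← ih]
      linear_combination hx n + x n * inv_mul_cancel₀ h0
  have hdefect_zero : x 1 - l * x 0 = 0 := by
    have hlim : Tendsto (fun n => ‖x (n + 1) - l * x n‖) atTop (𝓝 0) := by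
      simpa using ((ht.comp (tendsto_add_atTop_nat 1)).sub (ht.const_mul l)).norm
    refine norm_le_zero_iff.1 (ge_of_tendsto' hlim fun n => ?_)
    rw [hdefect n, norm_mul, norm_pow, norm_inv]
    exact le_mul_of_one_le_left (norm_nonneg _)
      (one_le_pow₀ ((one_le_inv₀ (norm_pos_iff.2 h0)).2 h1))
  induction n with
  | zero => rw [pow_zero, one_mul]
  | succ n ih =>
    have h := hdefect n
    rw [hdefect_zero, mul_zero, ih] at h
    rw [pow_succ']
    linear_combination h

theorem tendsto_vertexL2 (a : VertexL2) {τ : ℕ → ℤ} (hτ : Function.Injective τ) :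
    Tendsto (fun n => a (τ n)) atTop (𝓝 0) := by
  have hsq := ((lp.memℓp a).summable (by norm_num)).tendsto_cofinite_zero.comp hτ.tendsto_cofinite
  rw [Nat.cofinite_eq_atTop] at hsq
  rw [tendsto_zero_iff_norm_tendsto_zero]
  simpa using hsq.sqrt

theorem injective_add_units_mul_natCast (m : ℤ) (σ : ℤˣ) :
    Function.Injective fun n : ℕ => m + σ * n := by
  intro n k h
  rcases Int.units_eq_one_or σ with rfl | rfl <;> simpa using h

/-- `σ = ±1` is the direction of the half-line that starts at the vertex `m`. -/
theorem apply_add_eq_pow_mul {l : ℂ} (h0 : l ≠ 0) (h1 : ‖l‖ ≤ 1) {a : VertexL2} {m : ℤ} (σ : ℤˣ)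
    (ha : ∀ n : ℕ, a (m + σ * (n + 1) + 1) + a (m + σ * (n + 1) - 1) =
      (l + l⁻¹) * a (m + σ * (n + 1))) (n : ℕ) : a (m + σ * n) = l ^ n * a m := by
  have hpow := eq_pow_mul_of_tendsto_zero h0 h1 (x := fun n : ℕ => a (m + σ * n)) (fun n => ?_)
    (tendsto_vertexL2 a (injective_add_units_mul_natCast m σ)) n
  · simpa using hpow
  · have hn := ha n
    rcases Int.units_eq_one_or σ with rfl | rfl
    · convert hn using 3 <;> push_cast <;> ring_nf
    · rw [add_comm (a _) (a _)] at hn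
      convert hn using 3 <;> push_cast <;> ring_nf

theorem eq_zero_of_norm_multiplier_eq_one {l : ℂ} (hl : ‖l‖ = 1) {a : VertexL2} {m : ℤ} (σ : ℤˣ)
    (ha : ∀ n : ℕ, a (m + σ * (n + 1) + 1) + a (m + σ * (n + 1) - 1) =
      (l + l⁻¹) * a (m + σ * (n + 1))) (n : ℕ) : a (m + σ * n) = 0 := by
  have hpow := apply_add_eq_pow_mul (norm_ne_zero_iff.1 (hl ▸ one_ne_zero)) hl.le σ ha
  have hnorm := (tendsto_vertexL2 a (injective_add_units_mul_natCast m σ)).norm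
  simp only [hpow, norm_mul, norm_pow, hl, one_pow, one_mul, norm_zero] at hnorm
  rw [hpow, norm_eq_zero.1 (tendsto_nhds_unique tendsto_const_nhds hnorm), mul_zero]

/-- The sequence `l ^ |j - 1|`, which decays exponentially away from the vertex `1`. -/
def decaySeq {l : ℂ} (hl : ‖l‖ < 1) : VertexL2 :=
  ⟨fun j => l ^ (j - 1).natAbs, by
    refine memℓp_gen ?_
    have hgeom := summable_geometric_of_lt_one (sq_nonneg ‖l‖)
      (pow_lt_one₀ (norm_nonneg _) hl two_ne_zero)
    have hsum : Summable fun j : ℤ => (‖l‖ ^ 2) ^ j.natAbs :=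
      Summable.of_nat_of_neg (by simpa using hgeom) (by simpa using hgeom)
    refine (hsum.comp_injective (sub_left_injective (b := (1 : ℤ)))).congr fun j => ?_
    simp only [Function.comp_apply, norm_pow, ENNReal.toReal_ofNat, Real.rpow_ofNat]
    exact pow_right_comm _ _ _⟩

section DecaySeq

variable {l d : ℂ} (h0 : l ≠ 0) (h1 : ‖l‖ < 1)

theorem decaySeq_apply (j : ℤ) : decaySeq h1 j = l ^ (j - 1).natAbs := rfl

theorem decaySeq_ne_zero : decaySeq h1 ≠ 0 := fun h => by
  have hone := congrArg (fun a : VertexL2 => a 1) h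
  simp [decaySeq_apply] at hone

include h0

theorem vertexOp_decaySeq : vertexOp (l + l⁻¹) d (decaySeq h1) = lp.single 2 1 (l - l⁻¹ - d) := by
  ext j
  rw [vertexOp_apply]
  simp only [decaySeq_apply, lp.single_apply]
  rcases lt_trichotomy j 1 with hj | rfl | hj
  · obtain ⟨n, rfl⟩ : ∃ n : ℕ, j = -n := ⟨j.natAbs, by omega⟩
    rw [if_neg hj.ne, Pi.single_eq_of_ne hj.ne, show (-(n : ℤ) + 1 - 1).natAbs = n by omega,
      show (-(n : ℤ) - 1 - 1).natAbs = n + 2 by omega,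
      show (-(n : ℤ) - 1).natAbs = n + 1 by omega]
    field_simp
    ring
  · rw [if_pos rfl, Pi.single_eq_same]
    norm_num
  · obtain ⟨n, rfl⟩ : ∃ n : ℕ, j = n + 2 := ⟨(j - 2).natAbs, by omega⟩
    rw [if_neg hj.ne', Pi.single_eq_of_ne hj.ne',
      show ((n : ℤ) + 2 + 1 - 1).natAbs = n + 2 by omega,
      show ((n : ℤ) + 2 - 1 - 1).natAbs = n by omega,
      show ((n : ℤ) + 2 - 1).natAbs = n + 1 by omega]
    field_simp
    ring

theorem eq_smul_decaySeq_of_vertexOp_eq_zero {a : VertexL2} (ha : vertexOp (l + l⁻¹) d a = 0) :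
    a = a 1 • decaySeq h1 := by
  have hrec (j : ℤ) (hj : j ≠ 1) : a (j + 1) + a (j - 1) = (l + l⁻¹) * a j := by
    have h : vertexOp (l + l⁻¹) d a j = 0 := by rw [ha]; rfl
    rw [vertexOp_apply, if_neg hj] at h
    linear_combination h
  have hhalf (σ : ℤˣ) (n : ℕ) : a (1 + σ * n) = l ^ n * a 1 := by
    refine apply_add_eq_pow_mul h0 h1.le σ (fun n => hrec _ ?_) n
    rcases Int.units_eq_one_or σ with rfl | rfl <;> push_cast <;> omega
  ext j
  rw [lp.coeFn_smul, Pi.smul_apply, decaySeq_apply, smul_eq_mul, mul_comm]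
  rcases le_total 1 j with hj | hj
  · simpa [abs_of_nonneg (sub_nonneg.2 hj)] using hhalf 1 (j - 1).natAbs
  · simpa [abs_of_nonpos (sub_nonpos.2 hj)] using hhalf (-1) (j - 1).natAbs

include h1 in
theorem exists_vertexOp_eq_zero_iff :
    (∃ a ≠ 0, vertexOp (l + l⁻¹) d a = 0) ↔ l - l⁻¹ = d := by
  have hsingle : vertexOp (l + l⁻¹) d (decaySeq h1) = 0 ↔ l - l⁻¹ = d := by
    rw [vertexOp_decaySeq h0 h1, ← sub_eq_zero (b := d)]
    refine ⟨fun h => ?_, fun h => by rw [h]; exact lp.single_zero _ _⟩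
    exact (lp.single_apply_self 2 (1 : ℤ) _).symm.trans (congrArg (fun b : VertexL2 => b 1) h)
  refine ⟨fun ⟨a, hne, ha⟩ => hsingle.1 ?_, fun h => ⟨_, decaySeq_ne_zero h1, hsingle.2 h⟩⟩
  have hmul := eq_smul_decaySeq_of_vertexOp_eq_zero h0 h1 ha
  rw [hmul, map_smul] at ha
  exact (smul_eq_zero.1 ha).resolve_left fun h => hne (by rw [hmul, h, zero_smul])

end DecaySeq

end RingChain

namespace UnboundedOp

variable {E : Type*} [NormedAddCommGroup E] [InnerProductSpace ℂ E] {T : E →ₗ.[ℂ] E} {z : ℂ}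

theorem isEigenvalue_iff : IsEigenvalue T z ↔ ∃ u ≠ 0, (u, z • u) ∈ T.graph := by
  constructor
  · rintro ⟨u, hu, h⟩
    exact ⟨u, hu, T.mem_graph_iff.2 ⟨u, rfl, h⟩⟩
  · rintro ⟨u, hu, h⟩
    obtain ⟨y, rfl, hT⟩ := T.mem_graph_iff.1 h
    exact ⟨y, hu, hT⟩

theorem mem_resolventSet_of_graph (R : E →L[ℂ] E) (hmem : ∀ f, (R f, f + z • R f) ∈ T.graph)
    (huniq : ∀ u f, (u, f + z • u) ∈ T.graph → R f = u) : z ∈ resolventSet T := by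
  refine ⟨R, fun f => ?_, fun u => huniq u _ ?_⟩
  · obtain ⟨y, hy, hT⟩ := T.mem_graph_iff.1 (hmem f)
    simp only at hy hT
    simp only [← hy, SetLike.coe_mem, Subtype.coe_eta, exists_true_left]
    rw [hT, hy, add_sub_cancel_right]
  · rw [sub_add_cancel]
    exact T.mem_graph u

theorem exists_graph_of_mem_resolventSet (hz : z ∈ resolventSet T) (f : E) :
    ∃ u, (u, f + z • u) ∈ T.graph := by
  obtain ⟨R, hR, -⟩ := hz
  obtain ⟨h, hf⟩ := hR f
  exact ⟨R f, T.mem_graph_iff.2 ⟨⟨R f, h⟩, rfl, sub_eq_iff_eq_add.1 hf⟩⟩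

theorem IsEigenvalue.mem_spectrum (h : IsEigenvalue T z) : z ∈ spectrum T := by
  obtain ⟨u, hu, hT⟩ := h
  rintro ⟨R, -, hR⟩
  exact hu (by rw [← hR u, hT, sub_self, map_zero])

end UnboundedOp

namespace RingChain

/-! ### The chain operators in terms of vertex values -/

section EdgeMap

variable {X Y : Type*} [NormedAddCommGroup X] [NormedSpace ℂ X] [NormedAddCommGroup Y]
  [NormedSpace ℂ Y]

/-- Edgewise application of the operators `T true` on the upper and `T false` on the lower
semicircles. -/
def edgeMap (T : Bool → X →L[ℂ] Y) :
    lp (fun _ : Edge => X) 2 →L[ℂ] lp (fun _ : Edge => Y) 2 :=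
  lp.mapCLM 2 (fun e : Edge => T e.2) (K := ‖T true‖ + ‖T false‖) (by positivity) fun e => by
    cases e.2
    · exact le_add_of_nonneg_left (norm_nonneg _)
    · exact le_add_of_nonneg_right (norm_nonneg _)

theorem edgeMap_apply (T : Bool → X →L[ℂ] Y) (f : lp (fun _ : Edge => X) 2) (e : Edge) :
    edgeMap T f e = T e.2 (f e) := rfl

/-- The restriction of a family on the edges to the edges of type `s`, translated by `m`. -/
def edgePull (m : ℤ) (s : Bool) : lp (fun _ : Edge => X) 2 →L[ℂ] lp (fun _ : ℤ => X) 2 :=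
  lpPull (fun j => (j + m, s)) Set.univ fun i _ j _ h => by simpa using h

theorem edgePull_apply (m : ℤ) (s : Bool) (f : lp (fun _ : Edge => X) 2) (j : ℤ) :
    edgePull m s f j = f (j + m, s) :=
  (lpPull_apply _ _ _ f j).trans (congrFun (Set.indicator_univ _) j)

end EdgeMap

/-- The family of the values at the left ends of the edges. -/
def leftValue : VertexL2 →L[ℂ] lp (fun _ : Edge => ℂ) 2 :=
  ∑ s, lpPull Prod.fst {e : Edge | e.2 = s} fun _ he _ hf h => Prod.ext h (he.trans hf.symm)

theorem leftValue_apply (a : VertexL2) (e : Edge) : leftValue a e = a e.1 := by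
  have happly : leftValue a e = ∑ s, Set.indicator {e : Edge | e.2 = s} (fun e => a e.1) e := by
    simp only [leftValue, Fintype.sum_bool]
    rfl
  refine happly.trans ?_
  rcases e with ⟨j, _ | _⟩ <;> simp

/-- The function on the chain with the given vertex values that solves `-𝓓²ψ = zψ` on every
edge. -/
def vertexLift (A : ℤ) (z : ℂ) : VertexL2 →L[ℂ] L2Chain :=
  edgeMap (fun s => ContinuousLinearMap.toSpanSingleton ℂ
      (edgeCLM (quasiCoeff A s) z (1, initSlope A z s 1 0 0, 0))) ∘L leftValue +
    edgeMap (fun s => ContinuousLinearMap.toSpanSingleton ℂ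
      (edgeCLM (quasiCoeff A s) z (0, initSlope A z s 0 1 0, 0))) ∘L leftValue ∘L shift 1

/-- The function on the chain with zero vertex values that solves `-𝓓²ψ - zψ = f` on every
edge. -/
def dirichletLift (A : ℤ) (z : ℂ) : L2Chain →L[ℂ] L2Chain :=
  edgeMap fun s => edgeCLM (quasiCoeff A s) z ∘L
    (ContinuousLinearMap.prod 0 (ContinuousLinearMap.prod
      (cosFun (quasiCoeff A s) z Real.pi -
        (cosRoot z Real.pi / sinRoot z Real.pi) • sinFun (quasiCoeff A s) z Real.pi)
      (ContinuousLinearMap.id ℂ EdgeL2)))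

theorem vertexLift_add_dirichletLift (A : ℤ) (z : ℂ) (a : VertexL2) (f : L2Chain) (e : Edge) :
    (vertexLift A z a + dirichletLift A z f) e = edgeCLM (quasiCoeff A e.2) z
      (a e.1, initSlope A z e.2 (a e.1) (a (e.1 + 1)) (f e), f e) := by
  have happly : (vertexLift A z a + dirichletLift A z f) e =
      leftValue a e • edgeCLM (quasiCoeff A e.2) z (1, initSlope A z e.2 1 0 0, 0) +
      leftValue (shift 1 a) e • edgeCLM (quasiCoeff A e.2) z (0, initSlope A z e.2 0 1 0, 0) +
      edgeCLM (quasiCoeff A e.2) z (0, cosFun (quasiCoeff A e.2) z Real.pi (f e) -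
        (cosRoot z Real.pi / sinRoot z Real.pi) * sinFun (quasiCoeff A e.2) z Real.pi (f e),
        f e) := rfl
  rw [happly, leftValue_apply, leftValue_apply, shift_apply, ← map_smul, ← map_smul, ← map_add,
    ← map_add]
  congr 1
  simp only [Prod.smul_mk, Prod.mk_add_mk, smul_eq_mul, mul_one, mul_zero, smul_zero, add_zero,
    zero_add, Prod.mk.injEq, true_and, and_true, initSlope, map_zero]
  ring

theorem vertexLift_eq_zero {A : ℤ} {z : ℂ} {a : VertexL2} (h : vertexLift A z a = 0) : a = 0 := by
  ext j
  have hj := vertexLift_add_dirichletLift A z a 0 (j, true)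
  rw [h, map_zero, add_zero] at hj
  exact (eq_zero_of_edgeCLM_eq_zero hj.symm).1

/-- The operator with values `vertexSource A z`. -/
def vertexSourceCLM (A : ℤ) (z : ℂ) : L2Chain →L[ℂ] VertexL2 :=
  -(magSign A / 2) • ∑ s, edgePull 0 s ∘L edgeMap (fun s => sinRevFun (quasiCoeff A s) z) +
    -(1 / 2 : ℂ) • ∑ s, edgePull (-1) s ∘L edgeMap (fun s => sinFun (quasiCoeff A s) z Real.pi)

theorem vertexSourceCLM_apply (A : ℤ) (z : ℂ) (f : L2Chain) (j : ℤ) :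
    vertexSourceCLM A z f j = vertexSource A z f j := by
  simp only [vertexSourceCLM, vertexSource, Fintype.sum_bool]
  have happly (T S : Bool → EdgeL2 →L[ℂ] ℂ) (k k' : ℂ) (m m' : ℤ) :
      ((k • (edgePull m true ∘L edgeMap T + edgePull m false ∘L edgeMap T) +
        k' • (edgePull m' true ∘L edgeMap S + edgePull m' false ∘L edgeMap S)) f) j =
      k * (edgePull m true (edgeMap T f) j + edgePull m false (edgeMap T f) j) +
        k' * (edgePull m' true (edgeMap S f) j + edgePull m' false (edgeMap S f) j) := rfl
  rw [happly]
  simp only [edgePull_apply, edgeMap_apply, add_zero, ← sub_eq_add_neg]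

/-- Half the trace of the monodromy matrix of the unperturbed chain. -/
def discr (α : ℝ) (z : ℂ) : ℂ := cosRoot z Real.pi + α / 4 * sinRoot z Real.pi

/-- The spectral bands of the unperturbed chain. -/
def band (α : ℝ) : Set ℂ := {z | ∃ r ∈ Set.Icc (-1 : ℝ) 1, discr α z = r}

/-- The difference operator for the vertex values of the chain with an impurity of strength `γ` at
the vertex `1`. -/
def impurityVertexOp (A : ℤ) (α γ : ℝ) (z : ℂ) : VertexL2 →L[ℂ] VertexL2 :=
  vertexOp (magSign A * (2 * discr α z)) (magSign A * (γ * sinRoot z Real.pi / 2))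

theorem impurityVertexOp_apply (A : ℤ) (α γ : ℝ) (z : ℂ) (a : VertexL2) (j : ℤ) :
    impurityVertexOp A α γ z a j = a (j + 1) + a (j - 1) - magSign A * (2 * cosRoot z Real.pi +
      ((if j = 1 then α + γ else α : ℝ) : ℂ) * sinRoot z Real.pi / 2) * a j := by
  rw [impurityVertexOp, vertexOp_apply, discr]
  split_ifs <;> push_cast <;> ring

theorem memℓp_of_edgeCLM {c z : ℂ} {s : Bool} {u f : L2Chain} {a b : ℤ → ℂ}
    (h : ∀ j, u (j, s) = edgeCLM c z (a j, b j, f (j, s))) : Memℓp a 2 := by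
  obtain ⟨K, -, hK⟩ := exists_norm_le_edgeCLM c z
  refine (((lp.memℓp (edgePull 0 s u)).norm.add
    (lp.memℓp (edgePull 0 s f)).norm).const_mul K).mono fun j => ?_
  have hj := hK (a j) (b j) (f (j, s))
  rw [← h j] at hj
  exact hj.trans_eq (by simp [edgePull_apply])

theorem mem_graph_impurityHamiltonian_iff (A : ℤ) (α γ : ℝ) {z : ℂ} (hz : sinRoot z Real.pi ≠ 0)
    (u f : L2Chain) :
    (u, f + z • u) ∈ (impurityHamiltonian A α γ).graph ↔ ∃ a : VertexL2,
      impurityVertexOp A α γ z a = vertexSourceCLM A z f ∧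
        u = vertexLift A z a + dirichletLift A z f := by
  rw [impurityHamiltonian, hamiltonian_graph, mem_hamiltonianGraph_iff hz]
  constructor
  · rintro ⟨a, hu, ha⟩
    refine ⟨⟨a, memℓp_of_edgeCLM fun j => hu (j, true)⟩, ?_, ?_⟩
    · ext j
      rw [impurityVertexOp_apply, vertexSourceCLM_apply]
      exact ha j
    · refine lp.ext (funext fun e => ?_)
      rw [vertexLift_add_dirichletLift]
      exact hu e
  · rintro ⟨a, ha, hu⟩
    refine ⟨a, fun e => ?_, fun j => ?_⟩
    · rw [hu, vertexLift_add_dirichletLift]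
    · rw [← impurityVertexOp_apply, ha, vertexSourceCLM_apply]

theorem smul_mem_graph_impurityHamiltonian_iff (A : ℤ) (α γ : ℝ) {z : ℂ}
    (hz : sinRoot z Real.pi ≠ 0) (u : L2Chain) :
    (u, z • u) ∈ (impurityHamiltonian A α γ).graph ↔
      ∃ a : VertexL2, impurityVertexOp A α γ z a = 0 ∧ u = vertexLift A z a := by
  simpa using mem_graph_impurityHamiltonian_iff A α γ hz u 0

theorem isEigenvalue_iff_exists_vertex (A : ℤ) (α γ : ℝ) {z : ℂ} (hz : sinRoot z Real.pi ≠ 0) :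
    UnboundedOp.IsEigenvalue (impurityHamiltonian A α γ) z ↔
      ∃ a ≠ 0, impurityVertexOp A α γ z a = 0 := by
  rw [UnboundedOp.isEigenvalue_iff]
  constructor
  · rintro ⟨u, hu, h⟩
    obtain ⟨a, ha, rfl⟩ := (smul_mem_graph_impurityHamiltonian_iff A α γ hz u).1 h
    exact ⟨a, fun h0 => hu (by rw [h0, map_zero]), ha⟩
  · rintro ⟨a, hne, ha⟩
    exact ⟨vertexLift A z a, fun h => hne (vertexLift_eq_zero h),
      (smul_mem_graph_impurityHamiltonian_iff A α γ hz _).2 ⟨a, ha, rfl⟩⟩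

theorem mem_resolventSet_of_isUnit {A : ℤ} {α γ : ℝ} {z : ℂ} (hz : sinRoot z Real.pi ≠ 0)
    (hunit : IsUnit (impurityVertexOp A α γ z)) :
    z ∈ UnboundedOp.resolventSet (impurityHamiltonian A α γ) := by
  have hgraph := mem_graph_impurityHamiltonian_iff A α γ hz
  set K := impurityVertexOp A α γ z
  have hright (b : VertexL2) : K (Ring.inverse K b) = b :=
    DFunLike.congr_fun (Ring.mul_inverse_cancel K hunit) b
  have hleft (b : VertexL2) : Ring.inverse K (K b) = b :=
    DFunLike.congr_fun (Ring.inverse_mul_cancel K hunit) b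
  refine UnboundedOp.mem_resolventSet_of_graph
    (vertexLift A z ∘L Ring.inverse K ∘L vertexSourceCLM A z + dirichletLift A z)
    (fun f => (hgraph _ f).2 ⟨Ring.inverse K (vertexSourceCLM A z f), hright _, rfl⟩)
    fun u f h => ?_
  obtain ⟨a, ha, rfl⟩ := (hgraph u f).1 h
  change vertexLift A z (Ring.inverse K (vertexSourceCLM A z f)) + dirichletLift A z f = _
  rw [← ha, hleft]

/-! ### Outside of the bands -/

theorem mem_band_of_sinRoot_eq_zero (α : ℝ) {z : ℂ} (hz : sinRoot z Real.pi = 0) : z ∈ band α := by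
  have hsq := cosRoot_sq_add z Real.pi
  rw [hz] at hsq
  have hdiscr : discr α z = cosRoot z Real.pi := by rw [discr, hz, mul_zero, add_zero]
  rcases sq_eq_one_iff.1 (show cosRoot z Real.pi ^ 2 = 1 by linear_combination hsq) with h | h
  · exact ⟨1, by norm_num, by simp [hdiscr, h]⟩
  · exact ⟨-1, by norm_num, by simp [hdiscr, h]⟩

theorem sinRoot_pi_ne_zero_of_notMem_band {α : ℝ} {z : ℂ} (hz : z ∉ band α) :
    sinRoot z Real.pi ≠ 0 := fun h => hz (mem_band_of_sinRoot_eq_zero α h)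

theorem sinRoot_pi_eq_zero_iff {z : ℂ} :
    sinRoot z Real.pi = 0 ↔ ∃ n : ℕ, 1 ≤ n ∧ z = (n : ℂ) ^ 2 := by
  constructor
  · intro h
    have hsin := sqrt_mul_sinRoot z Real.pi
    rw [h, mul_zero] at hsin
    obtain ⟨n, hn⟩ := Complex.sin_eq_zero_iff.1 hsin.symm
    have hz : z = ((n.natAbs : ℤ) : ℂ) ^ 2 := by
      rw [← csqrt_sq z, mul_right_cancel₀ (Complex.ofReal_ne_zero.2 Real.pi_ne_zero) hn]
      exact_mod_cast (Int.natAbs_sq n).symm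
    refine ⟨n.natAbs, Nat.one_le_iff_ne_zero.2 fun hn0 => ?_, hz⟩
    rw [hz, hn0] at h
    simp [sinRoot] at h
  · rintro ⟨n, hn, rfl⟩
    have hsin := mul_sinRoot_sq (n : ℂ) Real.pi
    rw [Complex.sin_nat_mul_pi] at hsin
    exact (mul_eq_zero.1 hsin).resolve_left (Nat.cast_ne_zero.2 (by omega))

theorem mem_band_iff_magSign_mul_discr (A : ℤ) {α : ℝ} {z : ℂ} :
    z ∈ band α ↔ ∃ r ∈ Set.Icc (-1 : ℝ) 1, magSign A * (2 * discr α z) = 2 * r := by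
  rcases magSign_eq_or A with hA | hA <;> rw [hA]
  · simp [band]
  · constructor <;> rintro ⟨r, hr, h⟩ <;>
      refine ⟨-r, ⟨neg_le_neg hr.2, neg_le.1 hr.1⟩, ?_⟩ <;> push_cast
    · rw [h]
      ring
    · linear_combination -h / 2

theorem exists_multiplier (A : ℤ) {α : ℝ} {z : ℂ} (hz : z ∉ band α) :
    ∃ l : ℂ, l ≠ 0 ∧ ‖l‖ < 1 ∧ l + l⁻¹ = magSign A * (2 * discr α z) :=
  exists_norm_lt_one_add_inv_eq fun r hr h => hz ((mem_band_iff_magSign_mul_discr A).2 ⟨r, hr, h⟩)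

theorem mem_resolventSet_of_notMem_band (A : ℤ) {α γ : ℝ} {z : ℂ} (hz : z ∉ band α)
    (he : ¬ UnboundedOp.IsEigenvalue (impurityHamiltonian A α γ) z) :
    z ∈ UnboundedOp.resolventSet (impurityHamiltonian A α γ) := by
  have hs := sinRoot_pi_ne_zero_of_notMem_band hz
  obtain ⟨l, h0, h1, hl⟩ := exists_multiplier A hz
  refine mem_resolventSet_of_isUnit hs ?_
  have hker (a : VertexL2) (ha : impurityVertexOp A α γ z a = 0) : a = 0 := by
    by_contra hne
    exact he ((isEigenvalue_iff_exists_vertex A α γ hs).2 ⟨a, hne, ha⟩)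
  rw [impurityVertexOp, ← hl] at hker ⊢
  exact isUnit_vertexOp h0 h1 hker

theorem isEigenvalue_iff_of_notMem_band (A : ℤ) {α γ : ℝ} {z : ℂ} (hz : z ∉ band α) :
    UnboundedOp.IsEigenvalue (impurityHamiltonian A α γ) z ↔
      ∃ l : ℂ, l ≠ 0 ∧ ‖l‖ < 1 ∧ l + l⁻¹ = magSign A * (2 * discr α z) ∧
        l - l⁻¹ = magSign A * (γ * sinRoot z Real.pi / 2) := by
  rw [isEigenvalue_iff_exists_vertex A α γ (sinRoot_pi_ne_zero_of_notMem_band hz),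
    impurityVertexOp]
  constructor
  · intro h
    obtain ⟨l, h0, h1, hl⟩ := exists_multiplier A hz
    rw [← hl] at h
    exact ⟨l, h0, h1, hl, (exists_vertexOp_eq_zero_iff h0 h1).1 h⟩
  · rintro ⟨l, h0, h1, hl, hd⟩
    rw [← hl]
    exact (exists_vertexOp_eq_zero_iff h0 h1).2 hd

theorem isSimpleEigenvalue_of_notMem_band (A : ℤ) {α γ : ℝ} {z : ℂ} (hz : z ∉ band α)
    (he : UnboundedOp.IsEigenvalue (impurityHamiltonian A α γ) z) :
    UnboundedOp.IsSimpleEigenvalue (impurityHamiltonian A α γ) z := by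
  have hs := sinRoot_pi_ne_zero_of_notMem_band hz
  obtain ⟨l, h0, h1, hl⟩ := exists_multiplier A hz
  have hspan (w : L2Chain) (hw : w ∈ UnboundedOp.eigenspace (impurityHamiltonian A α γ) z) :
      ∃ c : ℂ, w = c • vertexLift A z (decaySeq h1) := by
    obtain ⟨a, ha, rfl⟩ := (smul_mem_graph_impurityHamiltonian_iff A α γ hs w).1 hw
    rw [impurityVertexOp, ← hl] at ha
    exact ⟨a 1, by rw [← map_smul, ← eq_smul_decaySeq_of_vertexOp_eq_zero h0 h1 ha]⟩
  refine ⟨he, ?_⟩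
  obtain ⟨u, hu, h⟩ : ∃ u ≠ 0, u ∈ UnboundedOp.eigenspace (impurityHamiltonian A α γ) z :=
    UnboundedOp.isEigenvalue_iff.1 he
  refine finrank_eq_one ⟨u, h⟩ (fun hzero => hu (congrArg Subtype.val hzero)) fun ⟨w, hw⟩ => ?_
  obtain ⟨c, rfl⟩ := hspan u h
  obtain ⟨k, rfl⟩ := hspan w hw
  have hc : c ≠ 0 := fun hc => hu (by rw [hc, zero_smul])
  exact ⟨k / c, Subtype.ext ((smul_smul _ _ _).trans (by rw [div_mul_cancel₀ k hc]))⟩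

/-! ### Inside of the bands -/

theorem eq_zero_of_recurrence_off_impurity {r : ℝ} (hr : r ∈ Set.Icc (-1) 1) {a : VertexL2}
    (ha : ∀ j, j ≤ 0 ∨ 3 ≤ j → a (j + 1) + a (j - 1) = 2 * r * a j) : a = 0 := by
  obtain ⟨l, hl, hsum⟩ := exists_norm_eq_one_add_inv_eq hr
  simp only [← hsum] at ha
  have hright := eq_zero_of_norm_multiplier_eq_one hl (m := 2) 1 fun n =>
    ha _ (Or.inr (by push_cast; omega))
  have hleft := eq_zero_of_norm_multiplier_eq_one hl (m := 1) (-1) fun n =>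
    ha _ (Or.inl (by push_cast; omega))
  ext j
  rcases le_or_gt 2 j with hj | hj
  · obtain ⟨n, rfl⟩ := Int.le.dest hj
    simpa using hright n
  · obtain ⟨n, hn⟩ := Int.le.dest (Int.le_of_lt_add_one (b := 1) hj)
    obtain rfl : j = 1 + ((-1 : ℤˣ) : ℤ) * n := by push_cast; omega
    exact hleft n

theorem not_isEigenvalue_of_mem_band (A : ℤ) {α γ : ℝ} {z : ℂ} (hz : z ∈ band α)
    (hs : sinRoot z Real.pi ≠ 0) :
    ¬ UnboundedOp.IsEigenvalue (impurityHamiltonian A α γ) z := by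
  rw [isEigenvalue_iff_exists_vertex A α γ hs]
  rintro ⟨a, hne, ha⟩
  obtain ⟨r, hr, hdiscr⟩ := (mem_band_iff_magSign_mul_discr A).1 hz
  refine hne (eq_zero_of_recurrence_off_impurity hr fun j hj => ?_)
  have h : impurityVertexOp A α γ z a j = 0 := by rw [ha]; rfl
  rw [impurityVertexOp, vertexOp_apply, hdiscr, if_neg (by omega)] at h
  linear_combination h

theorem sinFun_pi_ne_zero (c : ℂ) {z : ℂ} (hs : sinRoot z Real.pi ≠ 0) : sinFun c z Real.pi ≠ 0 :=
  integralCLM_pi_ne_zero _ pi_mem_Icc_pi (mul_ne_zero hs (Complex.exp_ne_zero _))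

theorem vertexSource_eq_zero (A : ℤ) (z : ℂ) {f : L2Chain} {j : ℤ} (h : ∀ s, f (j, s) = 0)
    (h' : ∀ s, f (j - 1, s) = 0) : vertexSource A z f j = 0 := by
  simp [vertexSource, h, h']

/-- A source on ring `1` acts on the vertices `1` and `2` only, so away from them the vertex values
satisfy a recurrence with bounded solutions and vanish; but then the source at the vertex `2` is
zero. -/
theorem mem_spectrum_of_mem_band (A : ℤ) {α γ : ℝ} {z : ℂ} (hz : z ∈ band α)
    (hs : sinRoot z Real.pi ≠ 0) :
    z ∈ UnboundedOp.spectrum (impurityHamiltonian A α γ) := by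
  intro hres
  obtain ⟨g, hg⟩ := DFunLike.ne_iff.1 (sinFun_pi_ne_zero (quasiCoeff A true) hs)
  set f : L2Chain := lp.single 2 ((1, true) : Edge) g
  have hf_ne (e : Edge) (he : e ≠ (1, true)) : f e = 0 := lp.single_apply_ne _ _ _ he
  obtain ⟨u, hu⟩ := UnboundedOp.exists_graph_of_mem_resolventSet hres f
  obtain ⟨a, ha, -⟩ := (mem_graph_impurityHamiltonian_iff A α γ hs u f).1 hu
  obtain ⟨r, hr, hdiscr⟩ := (mem_band_iff_magSign_mul_discr A).1 hz
  have happly (j : ℤ) : impurityVertexOp A α γ z a j = vertexSource A z f j := by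
    rw [ha, vertexSourceCLM_apply]
  have ha0 : a = 0 := by
    refine eq_zero_of_recurrence_off_impurity hr fun j hj => ?_
    have h := happly j
    rw [vertexSource_eq_zero A z (fun s => hf_ne _ (by simp; omega))
      (fun s => hf_ne _ (by simp; omega)), impurityVertexOp, vertexOp_apply, hdiscr,
      if_neg (by omega)] at h
    linear_combination h
  have h2 := happly 2
  have hf1 : f (2 - 1, true) = g := lp.single_apply_self _ _ _
  rw [ha0, map_zero, vertexSource, Fintype.sum_bool, Fintype.sum_bool, hf1, hf_ne (2, true),
    hf_ne (2, false), hf_ne (2 - 1, false)] at h2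
  · exact hg (by simpa using h2)
  all_goals simp

/-- The functions on the chain that vanish at the vertices, solve `-𝓓²ψ = zψ` on every edge, and
have initial slope `± a j` on the two edges of ring `j`. -/
def ringLift (A : ℤ) (z : ℂ) : VertexL2 →L[ℂ] L2Chain :=
  edgeMap (fun s => ContinuousLinearMap.toSpanSingleton ℂ
    (edgeCLM (quasiCoeff A s) z (0, if s then 1 else -1, 0))) ∘L leftValue

theorem ringLift_apply (A : ℤ) (z : ℂ) (a : VertexL2) (e : Edge) :
    ringLift A z a e = edgeCLM (quasiCoeff A e.2) z (0, if e.2 then a e.1 else -a e.1, 0) := by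
  have happly : ringLift A z a e =
    leftValue a e • edgeCLM (quasiCoeff A e.2) z (0, if e.2 then 1 else -1, 0) := rfl
  rw [happly, leftValue_apply, ← map_smul]
  congr 1
  rcases e with ⟨j, _ | _⟩ <;> simp

theorem injective_ringLift (A : ℤ) (z : ℂ) : Function.Injective (ringLift A z) := by
  refine (injective_iff_map_eq_zero _).2 fun a ha => lp.ext (funext fun j => ?_)
  have hj := ringLift_apply A z a (j, true)
  rw [ha] at hj
  exact (eq_zero_of_edgeCLM_eq_zero hj.symm).2

theorem ringLift_mem_eigenspace (A : ℤ) (α γ : ℝ) {z : ℂ} (hs : sinRoot z Real.pi = 0)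
    (a : VertexL2) :
    ringLift A z a ∈ UnboundedOp.eigenspace (impurityHamiltonian A α γ) z := by
  change (ringLift A z a, z • ringLift A z a) ∈ (impurityHamiltonian A α γ).graph
  rw [impurityHamiltonian, hamiltonian_graph, ← zero_add (z • _)]
  have hdata : IsVertexData A (fun j => if j = 1 then α + γ else α) z 0 (fun _ => 0)
      fun e => if e.2 then a e.1 else -a e.1 := by
    refine ⟨fun _ _ => rfl, fun j s => ?_, fun j => ?_⟩
    · rw [edgeSol_eq _ _ _ _ _ pi_mem_Icc_pi, hs, lp.coeFn_zero]
      simp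
    · simp only [edgeDer_eq _ _ _ _ _ pi_mem_Icc_pi, gauge_neg_quasiCoeff_pi, hs, lp.coeFn_zero,
        Pi.zero_apply, map_zero, Fintype.sum_bool]
      simp
  exact hdata.mem_hamiltonianGraph (ringLift_apply A z a)

theorem not_finiteDimensional_vertexL2 : ¬ FiniteDimensional ℂ VertexL2 := fun _ => by
  have hindep : LinearIndependent ℂ fun j : ℤ => (lp.single 2 j 1 : VertexL2) := by
    refine linearIndependent_of_ne_zero_of_inner_eq_zero (fun j hj => ?_) fun i j hij => ?_
    · exact one_ne_zero ((lp.single_apply_self 2 j 1).symm.trans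
        (congrArg (fun b : VertexL2 => b j) hj))
    · beta_reduce
      rw [lp.inner_single_left, lp.single_apply_ne _ _ _ hij, inner_zero_right]
  have := hindep.finite
  exact not_finite ℤ

theorem not_finiteDimensional_eigenspace (A : ℤ) (α γ : ℝ) {z : ℂ} (hs : sinRoot z Real.pi = 0) :
    ¬ FiniteDimensional ℂ (UnboundedOp.eigenspace (impurityHamiltonian A α γ) z) := fun _ =>
  not_finiteDimensional_vertexL2 <| FiniteDimensional.of_injective
    ((ringLift A z : VertexL2 →ₗ[ℂ] L2Chain).codRestrict _ (ringLift_mem_eigenspace A α γ hs))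
    ((LinearMap.injective_codRestrict_iff _).2 (injective_ringLift A z))

theorem mem_essSpectrum_of_mem_band (A : ℤ) {α : ℝ} (γ : ℝ) {z : ℂ} (hz : z ∈ band α) :
    z ∈ UnboundedOp.essSpectrum (impurityHamiltonian A α γ) := by
  by_cases hs : sinRoot z Real.pi = 0
  · have hfin := not_finiteDimensional_eigenspace A α γ hs
    have hbot : UnboundedOp.eigenspace (impurityHamiltonian A α γ) z ≠ ⊥ := fun hbot =>
      hfin (by rw [hbot]; infer_instance)
    obtain ⟨u, hu, hne⟩ := Submodule.exists_mem_ne_zero_of_ne_bot hbot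
    exact ⟨(UnboundedOp.isEigenvalue_iff.2 ⟨u, hne, hu⟩).mem_spectrum, fun h => hfin h.2.1⟩
  · exact ⟨mem_spectrum_of_mem_band A hz hs, fun h => not_isEigenvalue_of_mem_band A hz hs h.1⟩

/-! ### Factorization of the discriminant -/

/-- `α / 4 - √z tan (√z π / 2)`, which multiplied by `sinRoot z π` gives `discr α z - 1`. -/
def tanFactor (α : ℝ) (z : ℂ) : ℂ :=
  α / 4 - z * sinRoot z (Real.pi / 2) / cosRoot z (Real.pi / 2)

/-- `α / 4 + cot (√z π / 2) / √z`, which multiplied by `sinRoot z π` gives `discr α z + 1`. -/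
def cotFactor (α : ℝ) (z : ℂ) : ℂ :=
  α / 4 + cosRoot z (Real.pi / 2) / sinRoot z (Real.pi / 2)

theorem sinRoot_pi_eq_half (z : ℂ) :
    sinRoot z Real.pi = 2 * (sinRoot z (Real.pi / 2) * cosRoot z (Real.pi / 2)) := by
  have h := sinRoot_two_mul z (Real.pi / 2)
  rw [mul_div_cancel₀ _ two_ne_zero] at h
  rw [h]
  ring

theorem cosRoot_pi_eq_half (z : ℂ) :
    cosRoot z Real.pi = cosRoot z (Real.pi / 2) ^ 2 - z * sinRoot z (Real.pi / 2) ^ 2 := by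
  have h := cosRoot_two_mul z (Real.pi / 2)
  rwa [mul_div_cancel₀ _ two_ne_zero] at h

theorem sinRoot_half_ne_zero {z : ℂ} (hs : sinRoot z Real.pi ≠ 0) :
    sinRoot z (Real.pi / 2) ≠ 0 := fun h => hs (by rw [sinRoot_pi_eq_half, h]; ring)

theorem cosRoot_half_ne_zero {z : ℂ} (hs : sinRoot z Real.pi ≠ 0) :
    cosRoot z (Real.pi / 2) ≠ 0 := fun h => hs (by rw [sinRoot_pi_eq_half, h]; ring)

theorem discr_sub_one (α : ℝ) {z : ℂ} (hs : sinRoot z Real.pi ≠ 0) :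
    discr α z - 1 = tanFactor α z * sinRoot z Real.pi := by
  have h := cosRoot_half_ne_zero hs
  rw [discr, tanFactor, cosRoot_pi_eq_half, sinRoot_pi_eq_half]
  field_simp
  linear_combination 4 * cosRoot_sq_add z (Real.pi / 2)

theorem discr_add_one (α : ℝ) {z : ℂ} (hs : sinRoot z Real.pi ≠ 0) :
    discr α z + 1 = cotFactor α z * sinRoot z Real.pi := by
  have h := sinRoot_half_ne_zero hs
  rw [discr, cotFactor, cosRoot_pi_eq_half, sinRoot_pi_eq_half]
  field_simp
  linear_combination -4 * cosRoot_sq_add z (Real.pi / 2)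

theorem discr_sq_sub_one (α : ℝ) {z : ℂ} (hs : sinRoot z Real.pi ≠ 0) :
    discr α z ^ 2 - 1 = tanFactor α z * cotFactor α z * sinRoot z Real.pi ^ 2 := by
  linear_combination (discr α z + 1) * discr_sub_one α hs +
    tanFactor α z * sinRoot z Real.pi * discr_add_one α hs

theorem isEigenvalue_iff_tanFactor_mul_cotFactor (A : ℤ) {α γ : ℝ} {z : ℂ} (hz : z ∉ band α) :
    UnboundedOp.IsEigenvalue (impurityHamiltonian A α γ) z ↔
      tanFactor α z * cotFactor α z = γ ^ 2 / 16 ∧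
        ‖discr α z + γ * sinRoot z Real.pi / 4‖ < 1 := by
  have hs := sinRoot_pi_ne_zero_of_notMem_band hz
  have hsign := magSign_mul_self A
  have hnorm (w : ℂ) : ‖magSign A * w‖ = ‖w‖ := by
    rcases magSign_eq_or A with h | h <;> simp [h]
  have hsecular : (discr α z + γ * sinRoot z Real.pi / 4) *
      (discr α z - γ * sinRoot z Real.pi / 4) = 1 ↔
        tanFactor α z * cotFactor α z = γ ^ 2 / 16 := by
    rw [← mul_left_inj' (a := tanFactor α z * _) (pow_ne_zero 2 hs), ← discr_sq_sub_one α hs]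
    constructor <;> intro h <;> linear_combination h
  rw [isEigenvalue_iff_of_notMem_band A hz, ← hsecular]
  constructor
  · rintro ⟨l, hl0, hl1, hadd, hsub⟩
    have hl : l = magSign A * (discr α z + γ * sinRoot z Real.pi / 4) := by
      linear_combination hadd / 2 + hsub / 2
    have hl' : l⁻¹ = magSign A * (discr α z - γ * sinRoot z Real.pi / 4) := by
      linear_combination hadd / 2 - hsub / 2
    refine ⟨?_, by rwa [hl, hnorm] at hl1⟩
    have hmul := mul_inv_cancel₀ hl0
    rw [hl', hl] at hmul
    linear_combination hmul - (discr α z + γ * sinRoot z Real.pi / 4) *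
      (discr α z - γ * sinRoot z Real.pi / 4) * hsign
  · rintro ⟨hmul, hlt⟩
    have hinv : (magSign A * (discr α z + γ * sinRoot z Real.pi / 4))⁻¹ =
        magSign A * (discr α z - γ * sinRoot z Real.pi / 4) :=
      inv_eq_of_mul_eq_one_right (by linear_combination (discr α z + γ * sinRoot z Real.pi / 4) *
        (discr α z - γ * sinRoot z Real.pi / 4) * hsign + hmul)
    refine ⟨magSign A * (discr α z + γ * sinRoot z Real.pi / 4), fun h => ?_,
      by rwa [hnorm], by rw [hinv]; ring, by rw [hinv]; ring⟩
    have h0 := norm_eq_zero.2 h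
    rw [hnorm, norm_eq_zero] at h0
    rw [h0, zero_mul] at hmul
    exact zero_ne_one hmul

/-! ### Nonreal spectral parameters -/

theorem cosRoot_wronskian (z w : ℂ) (x : ℝ) :
    w * sinRoot w x * cosRoot z x - z * sinRoot z x * cosRoot w x =
      (w - z) * ∫ t in (0 : ℝ)..x, cosRoot w t * cosRoot z t := by
  have hderiv (t : ℝ) : HasDerivAt
      (fun t => w * sinRoot w t * cosRoot z t - z * sinRoot z t * cosRoot w t)
      ((w - z) * (cosRoot w t * cosRoot z t)) t := by
    refine ((((hasDerivAt_sinRoot w t).const_mul w).mul (hasDerivAt_cosRoot z t)).sub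
      (((hasDerivAt_sinRoot z t).const_mul z).mul (hasDerivAt_cosRoot w t))).congr_deriv ?_
    ring
  rw [← intervalIntegral.integral_const_mul,
    intervalIntegral.integral_eq_sub_of_hasDerivAt (fun t _ => hderiv t)
      ((by fun_prop : Continuous _).intervalIntegrable 0 x)]
  simp

theorem sinRoot_wronskian (z w : ℂ) (x : ℝ) :
    cosRoot w x * sinRoot z x - cosRoot z x * sinRoot w x =
      (z - w) * ∫ t in (0 : ℝ)..x, sinRoot w t * sinRoot z t := by
  have hderiv (t : ℝ) : HasDerivAt
      (fun t => cosRoot w t * sinRoot z t - cosRoot z t * sinRoot w t)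
      ((z - w) * (sinRoot w t * sinRoot z t)) t := by
    refine (((hasDerivAt_cosRoot w t).mul (hasDerivAt_sinRoot z t)).sub
      ((hasDerivAt_cosRoot z t).mul (hasDerivAt_sinRoot w t))).congr_deriv ?_
    ring
  rw [← intervalIntegral.integral_const_mul,
    intervalIntegral.integral_eq_sub_of_hasDerivAt (fun t _ => hderiv t)
      ((by fun_prop : Continuous _).intervalIntegrable 0 x)]
  simp

theorem integral_conj_mul_self (f : ℝ → ℂ) (a b : ℝ) :
    ∫ t in a..b, (starRingEnd ℂ) (f t) * f t = ((∫ t in a..b, ‖f t‖ ^ 2 : ℝ) : ℂ) := by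
  rw [← intervalIntegral.integral_ofReal]
  simp only [Complex.conj_mul', Complex.ofReal_pow]

theorem im_div_eq_of_conj_sub {a b c : ℂ} {r : ℝ} (hb : b ≠ 0)
    (h : (starRingEnd ℂ) a * b - a * (starRingEnd ℂ) b = ((starRingEnd ℂ) c - c) * r) :
    (a / b).im = c.im * (r / Complex.normSq b) := by
  have him := congrArg Complex.im h
  simp only [Complex.sub_im, Complex.mul_im, Complex.conj_re, Complex.conj_im, Complex.sub_re,
    Complex.ofReal_re, Complex.ofReal_im] at him
  have hb' := (Complex.normSq_pos.2 hb).ne'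
  rw [Complex.div_im]
  field_simp
  linarith

theorem exists_pos_im_tanFactor (α : ℝ) {z : ℂ} (hs : sinRoot z Real.pi ≠ 0) :
    ∃ p : ℝ, 0 < p ∧ (tanFactor α z).im = -(z.im * p) := by
  have hc := cosRoot_half_ne_zero hs
  have hint : 0 < ∫ t in (0 : ℝ)..(Real.pi / 2), ‖cosRoot z t‖ ^ 2 :=
    intervalIntegral.integral_pos (by positivity) (by fun_prop) (fun _ _ => sq_nonneg _)
      ⟨0, ⟨le_rfl, by positivity⟩, by simp⟩
  refine ⟨_, div_pos hint (Complex.normSq_pos.2 hc), ?_⟩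
  have hw := cosRoot_wronskian z ((starRingEnd ℂ) z) (Real.pi / 2)
  simp only [cosRoot_conj, sinRoot_conj, integral_conj_mul_self, ← map_mul] at hw
  have hα : ((α : ℂ) / 4).im = 0 := by simp
  rw [tanFactor, Complex.sub_im, hα, im_div_eq_of_conj_sub hc hw, zero_sub]

theorem exists_pos_im_cotFactor (α : ℝ) {z : ℂ} (hs : sinRoot z Real.pi ≠ 0) :
    ∃ q : ℝ, 0 < q ∧ (cotFactor α z).im = -(z.im * q) := by
  have hc := sinRoot_half_ne_zero hs
  have hint : 0 < ∫ t in (0 : ℝ)..(Real.pi / 2), ‖sinRoot z t‖ ^ 2 :=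
    intervalIntegral.integral_pos (by positivity) (by fun_prop) (fun _ _ => sq_nonneg _)
      ⟨Real.pi / 2, ⟨by positivity, le_rfl⟩, by positivity⟩
  refine ⟨_, div_pos hint (Complex.normSq_pos.2 hc), ?_⟩
  have hw := sinRoot_wronskian z ((starRingEnd ℂ) z) (Real.pi / 2)
  simp only [cosRoot_conj, sinRoot_conj, integral_conj_mul_self] at hw
  have hα : ((α : ℂ) / 4).im = 0 := by simp
  rw [cotFactor, Complex.add_im, hα, zero_add,
    im_div_eq_of_conj_sub (c := -z) hc (by rw [hw, map_neg]; ring), Complex.neg_im, neg_mul]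

theorem sinRoot_pi_ne_zero_of_im_ne_zero {z : ℂ} (hz : z.im ≠ 0) : sinRoot z Real.pi ≠ 0 := by
  rw [Ne, sinRoot_pi_eq_zero_iff]
  rintro ⟨n, -, rfl⟩
  exact hz (by norm_cast)

theorem notMem_band_of_im_ne_zero (α : ℝ) {z : ℂ} (hz : z.im ≠ 0) : z ∉ band α := by
  rintro ⟨r, ⟨hr₁, hr₂⟩, hr⟩
  have hs := sinRoot_pi_ne_zero_of_im_ne_zero hz
  obtain ⟨p, hp, hpim⟩ := exists_pos_im_tanFactor α hs
  obtain ⟨q, hq, hqim⟩ := exists_pos_im_cotFactor α hs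
  have hcomb : ((r + 1 : ℝ) : ℂ) * tanFactor α z + ((1 - r : ℝ) : ℂ) * cotFactor α z = 0 := by
    refine (mul_eq_zero.1 ?_).resolve_right hs
    push_cast
    linear_combination 2 * hr - (r + 1) * discr_sub_one α hs - (1 - r) * discr_add_one α hs
  have him := congrArg Complex.im hcomb
  rw [Complex.add_im, Complex.im_ofReal_mul, Complex.im_ofReal_mul, hpim, hqim,
    Complex.zero_im] at him
  have hzero : (r + 1) * p + (1 - r) * q = 0 :=
    (mul_eq_zero.1 (by linear_combination -him)).resolve_left hz
  nlinarith [mul_nonneg (neg_le_iff_add_nonneg.1 hr₁) hp.le, mul_nonneg (sub_nonneg.2 hr₂) hq.le]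

theorem not_isEigenvalue_of_im_ne_zero (A : ℤ) (α γ : ℝ) {z : ℂ} (hz : z.im ≠ 0) :
    ¬ UnboundedOp.IsEigenvalue (impurityHamiltonian A α γ) z := by
  rw [isEigenvalue_iff_tanFactor_mul_cotFactor A (notMem_band_of_im_ne_zero α hz)]
  rintro ⟨hprod, -⟩
  have hs := sinRoot_pi_ne_zero_of_im_ne_zero hz
  obtain ⟨p, hp, hpim⟩ := exists_pos_im_tanFactor α hs
  obtain ⟨q, hq, hqim⟩ := exists_pos_im_cotFactor α hs
  have hcot : cotFactor α z ≠ 0 := fun h => by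
    rw [h, Complex.zero_im, zero_eq_neg] at hqim
    exact mul_ne_zero hz hq.ne' hqim
  have hconj : tanFactor α z * ((Complex.normSq (cotFactor α z) : ℝ) : ℂ) =
      ((γ ^ 2 / 16 : ℝ) : ℂ) * (starRingEnd ℂ) (cotFactor α z) := by
    rw [← Complex.mul_conj]
    push_cast
    linear_combination (starRingEnd ℂ) (cotFactor α z) * hprod
  have him := congrArg Complex.im hconj
  rw [Complex.im_mul_ofReal, Complex.im_ofReal_mul, Complex.conj_im, hpim, hqim] at him
  have hzero : p * Complex.normSq (cotFactor α z) + γ ^ 2 / 16 * q = 0 :=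
    (mul_eq_zero.1 (by linear_combination -him)).resolve_left hz
  have hpos := mul_pos hp (Complex.normSq_pos.2 hcot)
  have hnonneg : 0 ≤ γ ^ 2 / 16 * q := by positivity
  linarith

/-! ### Real spectral parameters -/

/-- The restriction of `tanFactor` to real spectral parameters. -/
def realTanFactor (α x : ℝ) : ℝ :=
  α / 4 - x * realSinRoot x (Real.pi / 2) / realCosRoot x (Real.pi / 2)

/-- The restriction of `cotFactor` to real spectral parameters. -/
def realCotFactor (α x : ℝ) : ℝ :=
  α / 4 + realCosRoot x (Real.pi / 2) / realSinRoot x (Real.pi / 2)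

theorem ofReal_realTanFactor (α x : ℝ) : (realTanFactor α x : ℂ) = tanFactor α x := by
  rw [realTanFactor, tanFactor]
  push_cast
  rw [ofReal_realCosRoot, ofReal_realSinRoot]

theorem ofReal_realCotFactor (α x : ℝ) : (realCotFactor α x : ℂ) = cotFactor α x := by
  rw [realCotFactor, cotFactor]
  push_cast
  rw [ofReal_realCosRoot, ofReal_realSinRoot]

/-- The restriction of `discr` to real spectral parameters. -/
def realDiscr (α x : ℝ) : ℝ := realCosRoot x Real.pi + α / 4 * realSinRoot x Real.pi

theorem ofReal_realDiscr (α x : ℝ) : (realDiscr α x : ℂ) = discr α x := by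
  rw [realDiscr, discr]
  push_cast
  rw [ofReal_realCosRoot, ofReal_realSinRoot]

theorem sinRoot_ofReal_ne_zero_iff {x y : ℝ} : sinRoot x y ≠ 0 ↔ realSinRoot x y ≠ 0 := by
  rw [← ofReal_realSinRoot, Complex.ofReal_ne_zero]

theorem realDiscr_sub_one (α : ℝ) {x : ℝ} (hs : realSinRoot x Real.pi ≠ 0) :
    realDiscr α x - 1 = realTanFactor α x * realSinRoot x Real.pi := by
  have h := discr_sub_one α (sinRoot_ofReal_ne_zero_iff.2 hs)
  rw [← ofReal_realDiscr, ← ofReal_realTanFactor, ← ofReal_realSinRoot] at h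
  exact_mod_cast h

theorem realDiscr_add_one (α : ℝ) {x : ℝ} (hs : realSinRoot x Real.pi ≠ 0) :
    realDiscr α x + 1 = realCotFactor α x * realSinRoot x Real.pi := by
  have h := discr_add_one α (sinRoot_ofReal_ne_zero_iff.2 hs)
  rw [← ofReal_realDiscr, ← ofReal_realCotFactor, ← ofReal_realSinRoot] at h
  exact_mod_cast h

theorem realCotFactor_sub_realTanFactor (α : ℝ) {x : ℝ} (hs : realSinRoot x Real.pi ≠ 0) :
    (realCotFactor α x - realTanFactor α x) * realSinRoot x Real.pi = 2 := by
  linear_combination realDiscr_sub_one α hs - realDiscr_add_one α hs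

theorem ofReal_mem_band_iff {α x : ℝ} : (x : ℂ) ∈ band α ↔ realDiscr α x ^ 2 ≤ 1 := by
  rw [sq_le_one_iff_abs_le_one, abs_le]
  constructor
  · rintro ⟨r, hr, h⟩
    rw [← ofReal_realDiscr] at h
    rwa [Complex.ofReal_inj.1 h]
  · exact fun h => ⟨realDiscr α x, h, (ofReal_realDiscr α x).symm⟩

theorem ofReal_notMem_band_iff {α x : ℝ} :
    (x : ℂ) ∉ band α ↔
      realSinRoot x Real.pi ≠ 0 ∧ 0 < realTanFactor α x * realCotFactor α x := by
  by_cases hs : realSinRoot x Real.pi = 0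
  · have hband : (x : ℂ) ∈ band α :=
      mem_band_of_sinRoot_eq_zero α (by rw [← ofReal_realSinRoot, hs, Complex.ofReal_zero])
    simp [hband, hs]
  · have hsq : realDiscr α x ^ 2 - 1 =
        realTanFactor α x * realCotFactor α x * realSinRoot x Real.pi ^ 2 := by
      linear_combination (realDiscr α x + 1) * realDiscr_sub_one α hs +
        realTanFactor α x * realSinRoot x Real.pi * realDiscr_add_one α hs
    rw [ofReal_mem_band_iff, not_le, ← sub_pos, hsq,
      mul_pos_iff_of_pos_right (sq_pos_of_ne_zero hs), and_iff_right hs]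

theorem abs_add_lt_one_iff_mul_neg {d g : ℝ} (h : d ^ 2 - g ^ 2 = 1) :
    |d + g| < 1 ↔ g * d < 0 := by
  rw [← sq_lt_one_iff_abs_lt_one]
  constructor
  · intro hlt
    nlinarith
  · intro hneg
    nlinarith [sq_nonneg (d + g), sq_nonneg (d - g)]

theorem mul_add_neg_iff_of_mul_eq_sq {c p q : ℝ} (h : p * q = c ^ 2 / 16) :
    c * (p + q) < 0 ↔ c * p < 0 := by
  have hprod : (c * p) * (c * q) = (c ^ 2 / 4) ^ 2 := by linear_combination c ^ 2 * h
  constructor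
  · intro hsum
    by_contra! hp
    have hq : c * q < 0 := by linarith
    have hzero := (mul_nonpos_of_nonneg_of_nonpos hp hq.le).antisymm (hprod ▸ sq_nonneg _)
    rw [hprod] at hzero
    have hc : c = 0 := by simpa using hzero
    simp [hc] at hq
  · intro hp
    by_contra! hsum
    nlinarith [sq_nonneg (c ^ 2 / 4)]

theorem isEigenvalue_ofReal_iff (A : ℤ) {α γ x : ℝ} (hx : (x : ℂ) ∉ band α) :
    UnboundedOp.IsEigenvalue (impurityHamiltonian A α γ) (x : ℂ) ↔
      realTanFactor α x * realCotFactor α x = γ ^ 2 / 16 ∧ γ * realTanFactor α x < 0 := by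
  have hs := (ofReal_notMem_band_iff.1 hx).1
  have hnorm : ‖discr α x + γ * sinRoot x Real.pi / 4‖ =
      |realDiscr α x + γ * realSinRoot x Real.pi / 4| := by
    rw [← ofReal_realDiscr, ← ofReal_realSinRoot, ← Real.norm_eq_abs, ← Complex.norm_real]
    push_cast
    rfl
  rw [isEigenvalue_iff_tanFactor_mul_cotFactor A hx, hnorm, ← ofReal_realTanFactor,
    ← ofReal_realCotFactor]
  norm_cast
  refine and_congr_right fun hprod => ?_
  have hsub := realDiscr_sub_one α hs
  have hadd := realDiscr_add_one α hs
  have hdet : realDiscr α x ^ 2 - (γ * realSinRoot x Real.pi / 4) ^ 2 = 1 := by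
    linear_combination realSinRoot x Real.pi ^ 2 * hprod + (realDiscr α x + 1) * hsub +
      realTanFactor α x * realSinRoot x Real.pi * hadd
  have hsum : γ * realSinRoot x Real.pi / 4 * realDiscr α x =
      realSinRoot x Real.pi ^ 2 / 8 * (γ * (realTanFactor α x + realCotFactor α x)) := by
    linear_combination γ * realSinRoot x Real.pi / 8 * (hsub + hadd)
  rw [abs_add_lt_one_iff_mul_neg hdet, hsum, ← smul_eq_mul (a := _ / _),
    smul_neg_iff_of_pos_left (by positivity), mul_add_neg_iff_of_mul_eq_sq hprod]

/-! ### Monotonicity between consecutive Dirichlet eigenvalues -/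

theorem hasDerivAt_of_sub_eq_mul {f g : ℝ → ℝ} {x : ℝ} (hg : ContinuousAt g x)
    (h : ∀ᶠ y in 𝓝 x, f y - f x = (y - x) * g y) : HasDerivAt f (g x) x := by
  rw [hasDerivAt_iff_tendsto_slope]
  refine (hg.tendsto.mono_left nhdsWithin_le_nhds).congr' ?_
  filter_upwards [nhdsWithin_le_nhds h, self_mem_nhdsWithin] with y hy hne
  rw [slope_def_field, hy, mul_div_cancel_left₀ _ (sub_ne_zero.2 hne)]

theorem realCosRoot_wronskian (x y t : ℝ) :
    y * realSinRoot y t * realCosRoot x t - x * realSinRoot x t * realCosRoot y t =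
      (y - x) * ∫ u in (0 : ℝ)..t, realCosRoot y u * realCosRoot x u := by
  have h := cosRoot_wronskian x y t
  simp only [← ofReal_realCosRoot, ← ofReal_realSinRoot, ← Complex.ofReal_mul] at h
  rw [intervalIntegral.integral_ofReal] at h
  exact_mod_cast h

theorem realSinRoot_wronskian (x y t : ℝ) :
    realCosRoot y t * realSinRoot x t - realCosRoot x t * realSinRoot y t =
      (x - y) * ∫ u in (0 : ℝ)..t, realSinRoot y u * realSinRoot x u := by
  have h := sinRoot_wronskian x y t
  simp only [← ofReal_realCosRoot, ← ofReal_realSinRoot, ← Complex.ofReal_mul] at h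
  rw [intervalIntegral.integral_ofReal] at h
  exact_mod_cast h

theorem continuous_integral_mul_right {f : ℝ → ℝ → ℝ} (hf : Continuous fun p : ℝ × ℝ => f p.1 p.2)
    (x a b : ℝ) : Continuous fun y => ∫ u in a..b, f y u * f x u :=
  intervalIntegral.continuous_parametric_intervalIntegral_of_continuous' (by fun_prop) a b

theorem integral_mul_self_pos {f : ℝ → ℝ} (hf : Continuous f) {a b c : ℝ} (hab : a < b)
    (hc : c ∈ Set.Icc a b) (hfc : f c ≠ 0) : 0 < ∫ u in a..b, f u * f u :=
  intervalIntegral.integral_pos hab (by fun_prop) (fun _ _ => mul_self_nonneg _)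
    ⟨c, hc, mul_self_pos.2 hfc⟩

theorem realCosRoot_zero_right (x : ℝ) : realCosRoot x 0 = 1 := by
  simp [realCosRoot]

theorem integral_realCosRoot_mul_self_pos (x : ℝ) {t : ℝ} (ht : 0 < t) :
    0 < ∫ u in (0 : ℝ)..t, realCosRoot x u * realCosRoot x u := by
  have hcont := continuous_realCosRoot
  exact integral_mul_self_pos (by fun_prop) ht ⟨le_rfl, ht.le⟩
    ((realCosRoot_zero_right x).trans_ne one_ne_zero)

theorem hasDerivAt_realTanFactor (α : ℝ) {x : ℝ} (hc : realCosRoot x (Real.pi / 2) ≠ 0) :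
    HasDerivAt (realTanFactor α)
      (-((∫ u in (0 : ℝ)..(Real.pi / 2), realCosRoot x u * realCosRoot x u) /
        (realCosRoot x (Real.pi / 2) * realCosRoot x (Real.pi / 2)))) x := by
  have hcont := continuous_realCosRoot
  have hcont' : ContinuousAt (fun y => realCosRoot y (Real.pi / 2)) x := by fun_prop
  refine hasDerivAt_of_sub_eq_mul (g := fun y =>
    -((∫ u in (0 : ℝ)..(Real.pi / 2), realCosRoot y u * realCosRoot x u) /
      (realCosRoot y (Real.pi / 2) * realCosRoot x (Real.pi / 2))))
    (((continuous_integral_mul_right hcont x _ _).continuousAt.div (hcont'.mul_const _)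
      (mul_ne_zero hc hc)).neg) ?_
  filter_upwards [hcont'.eventually_ne hc] with y hy
  simp only [realTanFactor]
  field_simp
  linear_combination -4 * realCosRoot_wronskian x y (Real.pi / 2)

theorem hasDerivAt_realCotFactor (α : ℝ) {x : ℝ} (hs : realSinRoot x (Real.pi / 2) ≠ 0) :
    HasDerivAt (realCotFactor α)
      (-((∫ u in (0 : ℝ)..(Real.pi / 2), realSinRoot x u * realSinRoot x u) /
        (realSinRoot x (Real.pi / 2) * realSinRoot x (Real.pi / 2)))) x := by
  have hcont := continuous_realSinRoot
  have hcont' : ContinuousAt (fun y => realSinRoot y (Real.pi / 2)) x := by fun_prop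
  refine hasDerivAt_of_sub_eq_mul (g := fun y =>
    -((∫ u in (0 : ℝ)..(Real.pi / 2), realSinRoot y u * realSinRoot x u) /
      (realSinRoot y (Real.pi / 2) * realSinRoot x (Real.pi / 2))))
    (((continuous_integral_mul_right hcont x _ _).continuousAt.div (hcont'.mul_const _)
      (mul_ne_zero hs hs)).neg) ?_
  filter_upwards [hcont'.eventually_ne hs] with y hy
  simp only [realCotFactor]
  field_simp
  linear_combination 4 * realSinRoot_wronskian x y (Real.pi / 2)

theorem realSinRoot_half_ne_zero {x : ℝ} (hs : realSinRoot x Real.pi ≠ 0) :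
    realSinRoot x (Real.pi / 2) ≠ 0 := by
  have h := sinRoot_half_ne_zero (sinRoot_ofReal_ne_zero_iff.2 hs)
  rw [← ofReal_realSinRoot] at h
  exact_mod_cast h

theorem realCosRoot_half_ne_zero {x : ℝ} (hs : realSinRoot x Real.pi ≠ 0) :
    realCosRoot x (Real.pi / 2) ≠ 0 := by
  have h := cosRoot_half_ne_zero (sinRoot_ofReal_ne_zero_iff.2 hs)
  rw [← ofReal_realCosRoot] at h
  exact_mod_cast h

theorem continuousOn_realTanFactor (α : ℝ) {J : Set ℝ}
    (hs : ∀ x ∈ J, realSinRoot x Real.pi ≠ 0) : ContinuousOn (realTanFactor α) J := fun x hx =>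
  (hasDerivAt_realTanFactor α
    (realCosRoot_half_ne_zero (hs x hx))).continuousAt.continuousWithinAt

theorem continuousOn_realCotFactor (α : ℝ) {J : Set ℝ}
    (hs : ∀ x ∈ J, realSinRoot x Real.pi ≠ 0) : ContinuousOn (realCotFactor α) J := fun x hx =>
  (hasDerivAt_realCotFactor α
    (realSinRoot_half_ne_zero (hs x hx))).continuousAt.continuousWithinAt

theorem strictAntiOn_realTanFactor (α : ℝ) {J : Set ℝ} (hJ : J.OrdConnected)
    (hs : ∀ x ∈ J, realSinRoot x Real.pi ≠ 0) : StrictAntiOn (realTanFactor α) J := by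
  refine strictAntiOn_of_hasDerivWithinAt_neg hJ.convex (continuousOn_realTanFactor α hs)
    (fun x hx => (hasDerivAt_realTanFactor α
      (realCosRoot_half_ne_zero (hs x (interior_subset hx)))).hasDerivWithinAt) fun x hx => ?_
  exact neg_neg_of_pos (div_pos (integral_realCosRoot_mul_self_pos x (by positivity))
    (mul_self_pos.2 (realCosRoot_half_ne_zero (hs x (interior_subset hx)))))

theorem strictAntiOn_realCotFactor (α : ℝ) {J : Set ℝ} (hJ : J.OrdConnected)
    (hs : ∀ x ∈ J, realSinRoot x Real.pi ≠ 0) : StrictAntiOn (realCotFactor α) J := by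
  refine strictAntiOn_of_hasDerivWithinAt_neg hJ.convex (continuousOn_realCotFactor α hs)
    (fun x hx => (hasDerivAt_realCotFactor α
      (realSinRoot_half_ne_zero (hs x (interior_subset hx)))).hasDerivWithinAt) fun x hx => ?_
  have hcont := continuous_realSinRoot
  have hne := realSinRoot_half_ne_zero (hs x (interior_subset hx))
  exact neg_neg_of_pos (div_pos (integral_mul_self_pos (by fun_prop) (by positivity)
    ⟨by positivity, le_rfl⟩ hne) (mul_self_pos.2 hne))

/-- The `n`-th of the open intervals into which the points `m ^ 2`, `m ≥ 1`, divide the real line.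
The `0`-th one is `(-∞, 1)`, as `0` is not a Dirichlet eigenvalue of an edge. -/
def dirichletGap (n : ℕ) : Set ℝ := {x | (n = 0 ∨ (n : ℝ) ^ 2 < x) ∧ x < ((n : ℝ) + 1) ^ 2}

theorem ordConnected_dirichletGap (n : ℕ) : (dirichletGap n).OrdConnected :=
  ⟨fun _ hx _ hy _ hz => ⟨hx.1.imp_right fun h => h.trans_le hz.1, hz.2.trans_lt hy.2⟩⟩

theorem realSinRoot_pi_eq_zero_iff {x : ℝ} :
    realSinRoot x Real.pi = 0 ↔ ∃ n : ℕ, 1 ≤ n ∧ x = (n : ℝ) ^ 2 := by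
  have h := sinRoot_pi_eq_zero_iff (z := (x : ℂ))
  rw [← ofReal_realSinRoot] at h
  exact_mod_cast h

theorem realSinRoot_pi_ne_zero_of_mem_dirichletGap {n : ℕ} {x : ℝ} (hx : x ∈ dirichletGap n) :
    realSinRoot x Real.pi ≠ 0 := by
  rw [Ne, realSinRoot_pi_eq_zero_iff]
  rintro ⟨m, hm, rfl⟩
  have hlt : m < n + 1 := by
    exact_mod_cast lt_of_pow_lt_pow_left₀ 2 (by positivity) hx.2
  rcases hx.1 with rfl | hnm
  · omega
  · have : n < m := by exact_mod_cast lt_of_pow_lt_pow_left₀ 2 (by positivity) hnm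
    omega

theorem exists_mem_dirichletGap {x : ℝ} (hs : realSinRoot x Real.pi ≠ 0) :
    ∃ n, x ∈ dirichletGap n := by
  rcases lt_or_ge x 1 with h | h
  · exact ⟨0, Or.inl rfl, by simpa using h⟩
  · have hsq := Real.sq_sqrt (zero_le_one.trans h)
    have hle : ((⌊√x⌋₊ : ℕ) : ℝ) ^ 2 ≤ x :=
      (pow_le_pow_left₀ (by positivity) (Nat.floor_le (Real.sqrt_nonneg x)) 2).trans_eq hsq
    have hlt : x < ((⌊√x⌋₊ : ℕ) + 1 : ℝ) ^ 2 :=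
      hsq.symm.trans_lt (pow_lt_pow_left₀ (Nat.lt_floor_add_one _) (Real.sqrt_nonneg x)
        two_ne_zero)
    have hone : 1 ≤ ⌊√x⌋₊ := Nat.le_floor (by rw [Nat.cast_one]; exact Real.one_le_sqrt.2 h)
    exact ⟨⌊√x⌋₊, Or.inr (hle.lt_of_ne fun e =>
      hs (realSinRoot_pi_eq_zero_iff.2 ⟨_, hone, e.symm⟩)), hlt⟩

/-! ### Behaviour at the Dirichlet eigenvalues and at `-∞` -/

theorem realCosRoot_sq_add (x t : ℝ) :
    realCosRoot x t ^ 2 + x * realSinRoot x t ^ 2 = 1 := by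
  have h := cosRoot_sq_add x t
  rw [← ofReal_realCosRoot, ← ofReal_realSinRoot] at h
  exact_mod_cast h

theorem eventually_realSinRoot_div_realCosRoot_eq {x₀ t : ℝ} (hx₀ : 0 < x₀) (ht : 0 < t)
    (hs : realSinRoot x₀ t = 0) :
    ∀ᶠ x in 𝓝 x₀, ∃ c > 0, realSinRoot x t / realCosRoot x t = (x - x₀) * c := by
  have hcont := continuous_realCosRoot
  have hsq : realCosRoot x₀ t * realCosRoot x₀ t = 1 := by
    simpa [hs, sq] using realCosRoot_sq_add x₀ t
  have hden : ContinuousAt (fun x => x * (realCosRoot x t * realCosRoot x₀ t)) x₀ := by fun_prop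
  filter_upwards [(continuous_integral_mul_right continuous_realCosRoot x₀ 0
    t).continuousAt.eventually_const_lt (integral_realCosRoot_mul_self_pos x₀ ht),
    hden.eventually_const_lt (u := 0) (by simpa [hsq] using hx₀)] with x hint hpos
  refine ⟨_, div_pos hint hpos, ?_⟩
  rw [← mul_div_assoc, ← realCosRoot_wronskian, hs]
  have hx : x ≠ 0 := left_ne_zero_of_mul hpos.ne'
  have hC := left_ne_zero_of_mul (right_ne_zero_of_mul hpos.ne')
  have hC₀ := right_ne_zero_of_mul (right_ne_zero_of_mul hpos.ne')
  field_simp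
  ring

theorem tendsto_realSinRoot_div_realCosRoot {x₀ t : ℝ} (hs : realSinRoot x₀ t = 0) :
    Tendsto (fun x => realSinRoot x t / realCosRoot x t) (𝓝 x₀) (𝓝 0) := by
  have hcos := continuous_realCosRoot
  have hsin := continuous_realSinRoot
  have hC : realCosRoot x₀ t ≠ 0 := fun h => by
    simpa [hs, h] using realCosRoot_sq_add x₀ t
  have h : ContinuousAt (fun x => realSinRoot x t / realCosRoot x t) x₀ :=
    ContinuousAt.div (by fun_prop) (by fun_prop) hC
  simpa [ContinuousAt, hs] using h

theorem tendsto_realCosRoot_div_realSinRoot_nhdsGT {x₀ t : ℝ} (hx₀ : 0 < x₀) (ht : 0 < t)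
    (hs : realSinRoot x₀ t = 0) :
    Tendsto (fun x => realCosRoot x t / realSinRoot x t) (𝓝[>] x₀) atTop := by
  have hpos : ∀ᶠ x in 𝓝[>] x₀, 0 < realSinRoot x t / realCosRoot x t := by
    filter_upwards [nhdsWithin_le_nhds (eventually_realSinRoot_div_realCosRoot_eq hx₀ ht hs),
      self_mem_nhdsWithin] with x ⟨c, hc, hxc⟩ hx
    exact hxc ▸ mul_pos (sub_pos.2 hx) hc
  refine (tendsto_inv_nhdsGT_zero.comp (tendsto_nhdsWithin_iff.2
    ⟨(tendsto_realSinRoot_div_realCosRoot hs).mono_left nhdsWithin_le_nhds, hpos⟩)).congr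
    fun x => inv_div _ _

theorem tendsto_realCosRoot_div_realSinRoot_nhdsLT {x₀ t : ℝ} (hx₀ : 0 < x₀) (ht : 0 < t)
    (hs : realSinRoot x₀ t = 0) :
    Tendsto (fun x => realCosRoot x t / realSinRoot x t) (𝓝[<] x₀) atBot := by
  have hneg : ∀ᶠ x in 𝓝[<] x₀, realSinRoot x t / realCosRoot x t < 0 := by
    filter_upwards [nhdsWithin_le_nhds (eventually_realSinRoot_div_realCosRoot_eq hx₀ ht hs),
      self_mem_nhdsWithin] with x ⟨c, hc, hxc⟩ hx
    exact hxc ▸ mul_neg_of_neg_of_pos (sub_neg.2 hx) hc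
  refine (tendsto_inv_nhdsLT_zero.comp (tendsto_nhdsWithin_iff.2
    ⟨(tendsto_realSinRoot_div_realCosRoot hs).mono_left nhdsWithin_le_nhds, hneg⟩)).congr
    fun x => inv_div _ _

theorem realCosRoot_neg_sq (k t : ℝ) : realCosRoot (-k ^ 2) t = Real.cosh (k * t) := by
  have h := cosRoot_sq (k * Complex.I) t
  rw [mul_pow, Complex.I_sq, mul_right_comm, Complex.cos_mul_I] at h
  rw [realCosRoot]
  push_cast
  rw [← mul_neg_one, h]
  norm_cast

theorem mul_realSinRoot_neg_sq (k t : ℝ) :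
    k * realSinRoot (-k ^ 2) t = Real.sinh (k * t) := by
  have h := mul_sinRoot_sq (k * Complex.I) t
  rw [mul_pow, Complex.I_sq, mul_right_comm, mul_right_comm _ _ (t : ℂ), Complex.sin_mul_I] at h
  have h' := mul_right_cancel₀ Complex.I_ne_zero h
  rw [mul_neg_one] at h'
  have hcast : (k : ℂ) * realSinRoot (-k ^ 2) t = Complex.sinh (k * t) := by
    rw [ofReal_realSinRoot]
    push_cast
    exact h'
  exact_mod_cast hcast

theorem one_le_realSinRoot_pi_of_neg {x : ℝ} (hx : x < 0) : 1 ≤ realSinRoot x Real.pi := by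
  have hk : 0 < √(-x) := Real.sqrt_pos.2 (neg_pos.2 hx)
  have hsinh := mul_realSinRoot_neg_sq (√(-x)) Real.pi
  rw [Real.sq_sqrt (neg_pos.2 hx).le, neg_neg] at hsinh
  have hle := Real.self_le_sinh_iff.2 (mul_pos hk Real.pi_pos).le
  rw [← hsinh] at hle
  exact (by linarith [Real.pi_gt_three] : (1 : ℝ) ≤ Real.pi).trans
    (le_of_mul_le_mul_left hle hk)

theorem sqrt_neg_le_realCosRoot_div_realSinRoot {x : ℝ} (hx : x < 0) :
    √(-x) ≤ realCosRoot x Real.pi / realSinRoot x Real.pi := by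
  have hcosh := realCosRoot_neg_sq (√(-x)) Real.pi
  have hsinh := mul_realSinRoot_neg_sq (√(-x)) Real.pi
  rw [Real.sq_sqrt (neg_pos.2 hx).le, neg_neg] at hcosh hsinh
  rw [le_div_iff₀ (zero_lt_one.trans_le (one_le_realSinRoot_pi_of_neg hx)), hsinh, hcosh]
  exact (Real.sinh_lt_cosh _).le

theorem tendsto_realCosRoot_div_realSinRoot_atBot :
    Tendsto (fun x => realCosRoot x Real.pi / realSinRoot x Real.pi) atBot atTop :=
  tendsto_atTop_mono' _ ((eventually_lt_atBot 0).mono fun _ hx =>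
    sqrt_neg_le_realCosRoot_div_realSinRoot hx)
    (Real.tendsto_sqrt_atTop.comp tendsto_neg_atBot_atTop)

theorem realTanFactor_add_realCotFactor (α : ℝ) {x : ℝ} (hs : realSinRoot x Real.pi ≠ 0) :
    realTanFactor α x + realCotFactor α x =
      α / 2 + 2 * (realCosRoot x Real.pi / realSinRoot x Real.pi) := by
  have h₁ := realDiscr_sub_one α hs
  have h₂ := realDiscr_add_one α hs
  simp only [realDiscr] at h₁ h₂
  field_simp
  linear_combination -2 * (h₁ + h₂)

theorem exists_mem_dirichletGap_lt_add (α : ℝ) {n : ℕ} {x : ℝ} (hx : x ∈ dirichletGap n) (M : ℝ) :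
    ∃ y ∈ dirichletGap n, y < x ∧ M < realTanFactor α y + realCotFactor α y := by
  suffices h : ∃ y ∈ dirichletGap n, y < x ∧
      (M - α / 2) / 2 < realCosRoot y Real.pi / realSinRoot y Real.pi by
    obtain ⟨y, hy, hlt, hM⟩ := h
    refine ⟨y, hy, hlt, ?_⟩
    rw [realTanFactor_add_realCotFactor α (realSinRoot_pi_ne_zero_of_mem_dirichletGap hy)]
    linarith
  rcases Nat.eq_zero_or_pos n with rfl | hn
  · obtain ⟨y, hM, hlt⟩ := ((tendsto_realCosRoot_div_realSinRoot_atBot.eventually_gt_atTop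
      ((M - α / 2) / 2)).and (eventually_lt_atBot x)).exists
    exact ⟨y, ⟨Or.inl rfl, hlt.trans hx.2⟩, hlt, hM⟩
  · obtain ⟨y, hM, hy⟩ := (((tendsto_realCosRoot_div_realSinRoot_nhdsGT (x₀ := (n : ℝ) ^ 2)
      (by positivity) Real.pi_pos
      (realSinRoot_pi_eq_zero_iff.2 ⟨n, hn, rfl⟩)).eventually_gt_atTop ((M - α / 2) / 2)).and
      (Ioo_mem_nhdsGT (hx.1.resolve_left hn.ne'))).exists
    exact ⟨y, ⟨Or.inr hy.1, hy.2.trans hx.2⟩, hy.2, hM⟩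

theorem exists_mem_dirichletGap_add_lt (α : ℝ) {n : ℕ} {x : ℝ} (hx : x ∈ dirichletGap n) (M : ℝ) :
    ∃ y ∈ dirichletGap n, x < y ∧ realTanFactor α y + realCotFactor α y < M := by
  obtain ⟨y, hM, hy⟩ := (((tendsto_realCosRoot_div_realSinRoot_nhdsLT (x₀ := ((n : ℝ) + 1) ^ 2)
    (by positivity) Real.pi_pos
    (realSinRoot_pi_eq_zero_iff.2 ⟨n + 1, by omega, by norm_cast⟩)).eventually_lt_atBot
    ((M - α / 2) / 2)).and (Ioo_mem_nhdsLT hx.2)).exists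
  have hmem : y ∈ dirichletGap n := ⟨hx.1.imp_right fun h => h.trans hy.1, hy.2⟩
  refine ⟨y, hmem, hy.1, ?_⟩
  rw [realTanFactor_add_realCotFactor α (realSinRoot_pi_ne_zero_of_mem_dirichletGap hmem)]
  linarith

theorem le_mul_of_div_add_le_add {p q m t : ℝ} (hm : 0 < m) (hp : m ≤ p) (hq : m ≤ q)
    (h : t / m + m ≤ p + q) : t ≤ p * q := by
  have ht : t = t / m * m := (div_mul_cancel₀ t hm.ne').symm
  nlinarith [mul_nonneg (sub_nonneg.2 hp) (sub_nonneg.2 hq), mul_le_mul_of_nonneg_right h hm.le]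

theorem exists_pos_mul_eq {p q : ℝ → ℝ} {J : Set ℝ} (hJ : J.OrdConnected) (hp : ContinuousOn p J)
    (hq : ContinuousOn q J) {y₁ y₂ t : ℝ} (h₁ : y₁ ∈ J) (h₂ : y₂ ∈ J) (ht : 0 < t)
    (hp₁ : 0 < p y₁) (hq₁ : 0 < q y₁) (hle : t ≤ p y₁ * q y₁) (hsum : p y₂ + q y₂ ≤ 0) :
    ∃ y ∈ J, 0 < p y ∧ 0 < q y ∧ p y * q y = t := by
  have hsub : Set.uIcc y₁ y₂ ⊆ J := hJ.uIcc_subset h₁ h₂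
  have hcont : ContinuousOn (fun y => max (p y) 0 * max (q y) 0) (Set.uIcc y₁ y₂) :=
    ((hp.mono hsub).sup continuousOn_const).mul ((hq.mono hsub).sup continuousOn_const)
  have hzero : max (p y₂) 0 * max (q y₂) 0 = 0 := by
    rcases le_total (p y₂) 0 with h | h
    · rw [max_eq_right h, zero_mul]
    · rw [max_eq_right (by linarith : q y₂ ≤ 0), mul_zero]
  have hmem : t ∈ Set.uIcc (max (p y₁) 0 * max (q y₁) 0) (max (p y₂) 0 * max (q y₂) 0) := by
    rw [hzero, max_eq_left hp₁.le, max_eq_left hq₁.le, Set.uIcc_of_ge (ht.le.trans hle)]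
    exact ⟨ht.le, hle⟩
  obtain ⟨y, hy, rfl⟩ := intermediate_value_uIcc hcont hmem
  have hpy : 0 < p y := by simpa using pos_of_mul_pos_left ht (le_max_right _ _)
  have hqy : 0 < q y := by simpa using pos_of_mul_pos_right ht (le_max_right _ _)
  exact ⟨y, hsub hy, hpy, hqy, by simp only [max_eq_left hpy.le, max_eq_left hqy.le]⟩

theorem exists_mem_dirichletGap_mul_gt (α : ℝ) {c x : ℝ} {n : ℕ} (hc : c ≠ 0)
    (hx : x ∈ dirichletGap n) (M : ℝ) :
    ∃ y ∈ dirichletGap n, c * realTanFactor α x ≤ c * realTanFactor α y ∧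
      c * realCotFactor α x ≤ c * realCotFactor α y ∧
      M < c * (realTanFactor α y + realCotFactor α y) := by
  have hP := strictAntiOn_realTanFactor α (ordConnected_dirichletGap n)
    fun _ => realSinRoot_pi_ne_zero_of_mem_dirichletGap
  have hQ := strictAntiOn_realCotFactor α (ordConnected_dirichletGap n)
    fun _ => realSinRoot_pi_ne_zero_of_mem_dirichletGap
  rcases hc.lt_or_gt with hc | hc
  · obtain ⟨y, hy, hxy, hM⟩ := exists_mem_dirichletGap_add_lt α hx (M / c)
    exact ⟨y, hy, mul_le_mul_of_nonpos_left (hP hx hy hxy).le hc.le,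
      mul_le_mul_of_nonpos_left (hQ hx hy hxy).le hc.le, (lt_div_iff_of_neg' hc).1 hM⟩
  · obtain ⟨y, hy, hyx, hM⟩ := exists_mem_dirichletGap_lt_add α hx (M / c)
    exact ⟨y, hy, mul_le_mul_of_nonneg_left (hP hy hx hyx).le hc.le,
      mul_le_mul_of_nonneg_left (hQ hy hx hyx).le hc.le, (div_lt_iff₀' hc).1 hM⟩

theorem exists_mem_dirichletGap_mul_eq (α : ℝ) {γ x : ℝ} {n : ℕ} (hx : x ∈ dirichletGap n)
    (hP : γ * realTanFactor α x < 0) (hQ : γ * realCotFactor α x < 0) :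
    ∃ y ∈ dirichletGap n, γ * realTanFactor α y < 0 ∧ γ * realCotFactor α y < 0 ∧
      realTanFactor α y * realCotFactor α y = γ ^ 2 / 16 := by
  have hγ : γ ≠ 0 := left_ne_zero_of_mul hP.ne
  have hP' : 0 < -γ * realTanFactor α x := by rwa [neg_mul, neg_pos]
  have hQ' : 0 < -γ * realCotFactor α x := by rwa [neg_mul, neg_pos]
  set m := min (-γ * realTanFactor α x) (-γ * realCotFactor α x)
  have hm : 0 < m := lt_min hP' hQ'
  have hne := fun y => realSinRoot_pi_ne_zero_of_mem_dirichletGap (n := n) (x := y)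
  obtain ⟨y₁, h₁, hP₁, hQ₁, hM⟩ :=
    exists_mem_dirichletGap_mul_gt α (neg_ne_zero.2 hγ) hx (γ ^ 2 * (γ ^ 2 / 16) / m + m)
  obtain ⟨y₂, h₂, -, -, hneg⟩ := exists_mem_dirichletGap_mul_gt α hγ hx 0
  rw [mul_add] at hM
  obtain ⟨y, hy, hPy, hQy, hy_eq⟩ := exists_pos_mul_eq (ordConnected_dirichletGap n)
    ((continuousOn_realTanFactor α hne).const_mul (-γ))
    ((continuousOn_realCotFactor α hne).const_mul (-γ)) h₁ h₂ (by positivity)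
    (hP'.trans_le hP₁) (hQ'.trans_le hQ₁)
    (le_mul_of_div_add_le_add hm ((min_le_left _ _).trans hP₁) ((min_le_right _ _).trans hQ₁) hM.le)
    (by linarith)
  refine ⟨y, hy, by linarith, by linarith, mul_left_cancel₀ (pow_ne_zero 2 hγ) ?_⟩
  rw [← hy_eq]
  ring

/-! ### Signs of the two factors -/

theorem sub_realTanFactor_mul_realCotFactor_sub (α : ℝ) {x : ℝ}
    (hs : realSinRoot x Real.pi ≠ 0) :
    (α / 4 - realTanFactor α x) * (realCotFactor α x - α / 4) = x := by
  have hS := realSinRoot_half_ne_zero hs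
  have hC := realCosRoot_half_ne_zero hs
  rw [realTanFactor, realCotFactor]
  field_simp
  ring

theorem realTanFactor_lt_realCotFactor_of_neg (α : ℝ) {x : ℝ} (hx : x < 0) :
    realTanFactor α x < realCotFactor α x := by
  have hS := one_le_realSinRoot_pi_of_neg hx
  have h := realCotFactor_sub_realTanFactor α (zero_lt_one.trans_le hS).ne'
  exact sub_pos.1 (pos_of_mul_pos_left (h.symm ▸ two_pos) (zero_le_one.trans hS))

theorem realTanFactor_pos_of_notMem_band {α x : ℝ} (hα : 0 < α) (hx : (x : ℂ) ∉ band α) :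
    0 < realTanFactor α x := by
  obtain ⟨hs, hprod⟩ := ofReal_notMem_band_iff.1 hx
  by_contra! hP
  have hQ : realCotFactor α x < 0 := neg_of_mul_pos_right hprod hP
  have hneg : x < 0 := by
    rw [← sub_realTanFactor_mul_realCotFactor_sub α hs]
    exact mul_neg_of_pos_of_neg (by linarith) (by linarith)
  have hcot := (Real.sqrt_nonneg _).trans (sqrt_neg_le_realCosRoot_div_realSinRoot hneg)
  linarith [realTanFactor_add_realCotFactor α hs]

theorem neg_of_realTanFactor_pos {α x : ℝ} (hα : α < 0) (hx : (x : ℂ) ∉ band α)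
    (hP : 0 < realTanFactor α x) : x < 0 := by
  obtain ⟨hs, hprod⟩ := ofReal_notMem_band_iff.1 hx
  have hQ : 0 < realCotFactor α x := pos_of_mul_pos_right hprod hP.le
  rw [← sub_realTanFactor_mul_realCotFactor_sub α hs]
  exact mul_neg_of_neg_of_pos (by linarith) (by linarith)

theorem eventually_realTanFactor_pos (α : ℝ) : ∀ᶠ x in atBot, 0 < realTanFactor α x := by
  filter_upwards [eventually_lt_atBot 0,
    tendsto_realCosRoot_div_realSinRoot_atBot.eventually_gt_atTop (1 - α / 4)] with x hx hcot
  have hS := one_le_realSinRoot_pi_of_neg hx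
  have hs := (zero_lt_one.trans_le hS).ne'
  have hsub := realCotFactor_sub_realTanFactor α hs
  have hlt := sub_pos.2 (realTanFactor_lt_realCotFactor_of_neg α hx)
  have hle : realCotFactor α x - realTanFactor α x ≤ 2 :=
    (le_mul_of_one_le_right hlt.le hS).trans_eq hsub
  linarith [realTanFactor_add_realCotFactor α hs]

/-! ### The essential spectrum -/

theorem mul_realCotFactor_neg {α γ x : ℝ} (hx : (x : ℂ) ∉ band α)
    (h : γ * realTanFactor α x < 0) : γ * realCotFactor α x < 0 := by
  have hprod := (ofReal_notMem_band_iff.1 hx).2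
  have hγ : γ ≠ 0 := left_ne_zero_of_mul h.ne
  refine neg_of_mul_pos_right (a := γ * realTanFactor α x) ?_ h.le
  calc 0 < γ ^ 2 * (realTanFactor α x * realCotFactor α x) := by positivity
    _ = γ * realTanFactor α x * (γ * realCotFactor α x) := by ring

theorem eq_of_isEigenvalue (A : ℤ) {α γ : ℝ} {J : Set ℝ} (hJ : J.OrdConnected)
    (hband : ∀ x ∈ J, (x : ℂ) ∉ band α) {x y : ℝ} (hx : x ∈ J) (hy : y ∈ J)
    (hxe : UnboundedOp.IsEigenvalue (impurityHamiltonian A α γ) (x : ℂ))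
    (hye : UnboundedOp.IsEigenvalue (impurityHamiltonian A α γ) (y : ℂ)) : x = y := by
  wlog hxy : x ≤ y generalizing x y
  · exact (this hy hx hye hxe (le_of_not_ge hxy)).symm
  refine hxy.eq_of_not_lt fun hlt => ?_
  have hs : ∀ t ∈ J, realSinRoot t Real.pi ≠ 0 := fun t ht =>
    (ofReal_notMem_band_iff.1 (hband t ht)).1
  obtain ⟨hx_eq, hPx⟩ := (isEigenvalue_ofReal_iff A (hband x hx)).1 hxe
  obtain ⟨hy_eq, hPy⟩ := (isEigenvalue_ofReal_iff A (hband y hy)).1 hye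
  have hP := mul_neg_of_pos_of_neg (sub_pos.2 (strictAntiOn_realTanFactor α hJ hs hx hy hlt))
    (mul_realCotFactor_neg (hband x hx) hPx)
  have hQ := mul_neg_of_pos_of_neg (sub_pos.2 (strictAntiOn_realCotFactor α hJ hs hx hy hlt)) hPy
  refine (add_neg hP hQ).ne ?_
  linear_combination γ * (hx_eq - hy_eq)

theorem ofReal_re_eq_of_isEigenvalue {A : ℤ} {α γ : ℝ} {z : ℂ}
    (he : UnboundedOp.IsEigenvalue (impurityHamiltonian A α γ) z) : (z.re : ℂ) = z := by
  by_contra hz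
  exact not_isEigenvalue_of_im_ne_zero A α γ (fun h => hz (Complex.ext rfl h.symm)) he

theorem isOpen_setOf_ofReal_notMem_band (α : ℝ) : IsOpen {x : ℝ | (x : ℂ) ∉ band α} := by
  have hcos := continuous_realCosRoot
  have hsin := continuous_realSinRoot
  simp only [ofReal_mem_band_iff, not_le, realDiscr]
  exact isOpen_lt (by fun_prop) (by fun_prop)

theorem mem_discreteSpectrum (A : ℤ) {α γ : ℝ} {z : ℂ} (hz : z ∉ band α)
    (he : UnboundedOp.IsEigenvalue (impurityHamiltonian A α γ) z) :
    z ∈ UnboundedOp.discreteSpectrum (impurityHamiltonian A α γ) := by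
  refine ⟨he, Module.finite_of_finrank_eq_succ (isSimpleEigenvalue_of_notMem_band A hz he).2, ?_⟩
  obtain ⟨x, rfl⟩ : ∃ x : ℝ, (x : ℂ) = z := ⟨z.re, ofReal_re_eq_of_isEigenvalue he⟩
  have hgap : connectedComponentIn {y : ℝ | (y : ℂ) ∉ band α} x ∈ 𝓝 (x : ℂ).re :=
    (isOpen_setOf_ofReal_notMem_band α).connectedComponentIn.mem_nhds
      (mem_connectedComponentIn hz)
  filter_upwards [nhdsWithin_le_nhds (Complex.continuous_re.continuousAt hgap),
    self_mem_nhdsWithin] with w hw hne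
  rw [UnboundedOp.spectrum, Set.notMem_compl_iff]
  by_cases him : w.im = 0
  · obtain ⟨y, rfl⟩ : ∃ y : ℝ, (y : ℂ) = w := ⟨w.re, Complex.ext rfl him.symm⟩
    refine mem_resolventSet_of_notMem_band A (connectedComponentIn_subset _ _ hw) fun hye => hne ?_
    exact congrArg _ (eq_of_isEigenvalue A isPreconnected_connectedComponentIn.ordConnected
      (connectedComponentIn_subset _ _) hw (mem_connectedComponentIn hz) hye he)
  · exact mem_resolventSet_of_notMem_band A (notMem_band_of_im_ne_zero α him)
      (not_isEigenvalue_of_im_ne_zero A α γ him)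

theorem essSpectrum_impurityHamiltonian (A : ℤ) (α γ : ℝ) :
    UnboundedOp.essSpectrum (impurityHamiltonian A α γ) = band α := by
  refine Set.Subset.antisymm (fun z h => ?_) fun z => mem_essSpectrum_of_mem_band A γ
  by_contra hz
  by_cases he : UnboundedOp.IsEigenvalue (impurityHamiltonian A α γ) z
  · exact h.2 (mem_discreteSpectrum A hz he)
  · exact h.1 (mem_resolventSet_of_notMem_band A hz he)

theorem impurityHamiltonian_zero (A α : ℝ) :
    impurityHamiltonian A α 0 = periodicHamiltonian A α := by
  simp [periodicHamiltonian, impurityHamiltonian]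

theorem isEigenvalue_cases {A : ℤ} {α γ : ℝ} {z : ℂ}
    (he : UnboundedOp.IsEigenvalue (impurityHamiltonian A α γ) z) :
    (z ∈ UnboundedOp.essSpectrum (impurityHamiltonian A α γ) ∧
      ∃ n : ℕ, 1 ≤ n ∧ z = (n : ℂ) ^ 2) ∨
    ∃ x : ℝ, (x : ℂ) = z ∧ (x : ℂ) ∉ band α ∧ γ * realTanFactor α x < 0 := by
  by_cases hz : z ∈ band α
  · refine Or.inl ⟨mem_essSpectrum_of_mem_band A γ hz, sinRoot_pi_eq_zero_iff.1 ?_⟩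
    by_contra hs
    exact not_isEigenvalue_of_mem_band A hz hs he
  · have hre := ofReal_re_eq_of_isEigenvalue he
    rw [← hre] at hz he
    exact Or.inr ⟨z.re, hre, hz, ((isEigenvalue_ofReal_iff A hz).1 he).2⟩

theorem spectrum_periodicHamiltonian (A : ℤ) (α : ℝ) :
    UnboundedOp.spectrum (periodicHamiltonian A α) = band α := by
  rw [← impurityHamiltonian_zero]
  refine Set.Subset.antisymm (fun z h => ?_) fun z hz => (mem_essSpectrum_of_mem_band A 0 hz).1
  by_contra hz
  refine h (mem_resolventSet_of_notMem_band A hz fun he => ?_)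
  rcases isEigenvalue_cases he with ⟨hess, -⟩ | ⟨x, -, -, hneg⟩
  · exact hz (essSpectrum_impurityHamiltonian A α 0 ▸ hess)
  · simp at hneg

/-! ### Gaps -/

theorem mul_neg_of_mem_uIcc {c p q r : ℝ} (hp : c * p < 0) (hq : c * q < 0)
    (hr : r ∈ Set.uIcc p q) : c * r < 0 := by
  have hconv : Convex ℝ {t : ℝ | c * t < 0} :=
    convex_halfSpace_lt (LinearMap.mulLeft ℝ c).isLinear 0
  exact hconv.ordConnected.uIcc_subset hp hq hr

theorem hasUniqueSimpleEigenvalueIn (A : ℤ) {α γ x : ℝ} (hx : (x : ℂ) ∉ band α)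
    (hneg : γ * realTanFactor α x < 0) :
    UnboundedOp.HasUniqueSimpleEigenvalueIn (impurityHamiltonian A α γ)
      (connectedComponentIn {y : ℝ | (y : ℂ) ∉ band α} x) := by
  have hneg' := mul_realCotFactor_neg hx hneg
  obtain ⟨n, hn⟩ := exists_mem_dirichletGap (ofReal_notMem_band_iff.1 hx).1
  have hJ := ordConnected_dirichletGap n
  have hs := fun t => realSinRoot_pi_ne_zero_of_mem_dirichletGap (n := n) (x := t)
  obtain ⟨E, hE, hPE, hQE, hE_eq⟩ := exists_mem_dirichletGap_mul_eq α hn hneg hneg'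
  have hsub := hJ.uIcc_subset hn hE
  have hgap : Set.uIcc x E ⊆ {y : ℝ | (y : ℂ) ∉ band α} := fun t ht => by
    have hP := mul_neg_of_mem_uIcc hneg hPE
      (((strictAntiOn_realTanFactor α hJ hs).antitoneOn.mono hsub).mapsTo_uIcc ht)
    have hQ := mul_neg_of_mem_uIcc hneg' hQE
      (((strictAntiOn_realCotFactor α hJ hs).antitoneOn.mono hsub).mapsTo_uIcc ht)
    refine ofReal_notMem_band_iff.2 ⟨hs t (hsub ht),
      pos_of_mul_pos_right (a := γ ^ 2) ?_ (sq_nonneg γ)⟩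
    linear_combination mul_pos_of_neg_of_neg hP hQ
  have hE_gap := isPreconnected_uIcc.subset_connectedComponentIn Set.left_mem_uIcc hgap
    Set.right_mem_uIcc
  have hE_band := connectedComponentIn_subset _ _ hE_gap
  have hE_eig := (isEigenvalue_ofReal_iff A hE_band).2 ⟨hE_eq, hPE⟩
  exact ⟨E, hE_gap, isSimpleEigenvalue_of_notMem_band A hE_band hE_eig, fun y hy hye =>
    eq_of_isEigenvalue A isPreconnected_connectedComponentIn.ordConnected
      (connectedComponentIn_subset _ _) hy hE_gap hye hE_eig⟩

theorem mem_firstGap_iff (A : ℤ) (α γ : ℝ) {x : ℝ} :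
    x ∈ UnboundedOp.firstGap (impurityHamiltonian A α γ) ↔ ∀ y ≤ x, (y : ℂ) ∉ band α := by
  simp only [UnboundedOp.firstGap, essSpectrum_impurityHamiltonian, Set.mem_ofPred_eq]
  exact forall_congr' fun y => by rw [imp_not_comm, not_le]

theorem notMem_band_of_mem_firstGap {A : ℤ} {α γ x : ℝ}
    (hx : x ∈ UnboundedOp.firstGap (impurityHamiltonian A α γ)) : (x : ℂ) ∉ band α :=
  (mem_firstGap_iff A α γ).1 hx x le_rfl

theorem connectedComponentIn_eq_firstGap {A : ℤ} {α γ x : ℝ}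
    (hx : x ∈ UnboundedOp.firstGap (impurityHamiltonian A α γ)) :
    connectedComponentIn {y : ℝ | (y : ℂ) ∉ band α} x =
      UnboundedOp.firstGap (impurityHamiltonian A α γ) := by
  have hx' := (mem_firstGap_iff A α γ).1 hx
  refine Set.Subset.antisymm (fun y hy => (mem_firstGap_iff A α γ).2 fun t ht => ?_) ?_
  · rcases le_total t x with htx | hxt
    · exact hx' t htx
    · exact connectedComponentIn_subset _ _
        (isPreconnected_connectedComponentIn.ordConnected.out
          (mem_connectedComponentIn (hx' x le_rfl)) hy ⟨hxt, ht⟩)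
  · have hconn : (UnboundedOp.firstGap (impurityHamiltonian A α γ)).OrdConnected :=
      ⟨fun _ _ _ hb _ ht t hbt => ht.2.trans_lt (hb t hbt)⟩
    exact hconn.isPreconnected.subset_connectedComponentIn hx fun y => notMem_band_of_mem_firstGap

theorem realTanFactor_pos_of_mem_firstGap {A : ℤ} {α γ x : ℝ}
    (hx : x ∈ UnboundedOp.firstGap (impurityHamiltonian A α γ)) : 0 < realTanFactor α x := by
  have hband := (mem_firstGap_iff A α γ).1 hx
  obtain ⟨y, hPy, hyx⟩ := ((eventually_realTanFactor_pos α).and (eventually_le_atBot x)).exists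
  by_contra! hPx
  have hcont : ContinuousOn (realTanFactor α) (Set.Icc y x) :=
    continuousOn_realTanFactor α fun t ht => (ofReal_notMem_band_iff.1 (hband t ht.2)).1
  obtain ⟨t, ht, hzero⟩ := intermediate_value_Icc' hyx hcont ⟨hPx, hPy.le⟩
  have hprod := (ofReal_notMem_band_iff.1 (hband t ht.2)).2
  rw [hzero, zero_mul] at hprod
  exact hprod.false

theorem mem_firstGap_of_realTanFactor_pos (A : ℤ) {α : ℝ} (γ : ℝ) {x : ℝ} (hx : x < 0)
    (hP : 0 < realTanFactor α x) : x ∈ UnboundedOp.firstGap (impurityHamiltonian A α γ) := by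
  refine (mem_firstGap_iff A α γ).2 fun y hyx => ?_
  have hs : ∀ t ∈ Set.Iio (0 : ℝ), realSinRoot t Real.pi ≠ 0 := fun t ht =>
    (zero_lt_one.trans_le (one_le_realSinRoot_pi_of_neg ht)).ne'
  have hy : y < 0 := hyx.trans_lt hx
  have hPy : 0 < realTanFactor α y := hP.trans_le
    ((strictAntiOn_realTanFactor α Set.ordConnected_Iio hs).antitoneOn hy hx hyx)
  exact ofReal_notMem_band_iff.2 ⟨hs y hy,
    mul_pos hPy (hPy.trans (realTanFactor_lt_realCotFactor_of_neg α hy))⟩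

theorem mem_firstGap_iff_realTanFactor_pos (A : ℤ) {α : ℝ} (γ : ℝ) {x : ℝ} (hα : α < 0)
    (hx : (x : ℂ) ∉ band α) :
    x ∈ UnboundedOp.firstGap (impurityHamiltonian A α γ) ↔ 0 < realTanFactor α x :=
  ⟨realTanFactor_pos_of_mem_firstGap, fun hP =>
    mem_firstGap_of_realTanFactor_pos A γ (neg_of_realTanFactor_pos hα hx hP) hP⟩

theorem realTanFactor_neg_of_notMem_firstGap {A : ℤ} {α γ x : ℝ} (hα : α < 0)
    (hx : (x : ℂ) ∉ band α) (hgap : x ∉ UnboundedOp.firstGap (impurityHamiltonian A α γ)) :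
    realTanFactor α x < 0 :=
  (left_ne_zero_of_mul (ofReal_notMem_band_iff.1 hx).2.ne').lt_of_le <| not_lt.1 <|
    mt (mem_firstGap_iff_realTanFactor_pos A γ hα hx).2 hgap

theorem firstGap_nonempty (A : ℤ) (α γ : ℝ) :
    (UnboundedOp.firstGap (impurityHamiltonian A α γ)).Nonempty := by
  obtain ⟨x, hP, hx⟩ := ((eventually_realTanFactor_pos α).and (eventually_lt_atBot 0)).exists
  exact ⟨x, mem_firstGap_of_realTanFactor_pos A γ hx hP⟩

theorem hasUniqueSimpleEigenvalueIn_firstGap (A : ℤ) (α : ℝ) {γ : ℝ} (hγ : γ < 0) :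
    UnboundedOp.HasUniqueSimpleEigenvalueIn (impurityHamiltonian A α γ)
      (UnboundedOp.firstGap (impurityHamiltonian A α γ)) := by
  obtain ⟨x, hx⟩ := firstGap_nonempty A α γ
  rw [← connectedComponentIn_eq_firstGap hx]
  exact hasUniqueSimpleEigenvalueIn A (notMem_band_of_mem_firstGap hx)
    (mul_neg_of_neg_of_pos hγ (realTanFactor_pos_of_mem_firstGap hx))

theorem isGap_iff (A : ℤ) (α γ : ℝ) {G : Set ℝ} :
    UnboundedOp.IsGap (impurityHamiltonian A α γ) G ↔
      ∃ x : ℝ, (x : ℂ) ∉ band α ∧ G = connectedComponentIn {y : ℝ | (y : ℂ) ∉ band α} x := by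
  rw [UnboundedOp.IsGap, essSpectrum_impurityHamiltonian]

end RingChain

end

open RingChain in
theorem mainTheorem6 (A : ℤ) (α γ : ℝ) :
    (UnboundedOp.essSpectrum (RingChain.impurityHamiltonian A α γ) =
        UnboundedOp.essSpectrum (RingChain.periodicHamiltonian A α) ∧
      UnboundedOp.essSpectrum (RingChain.impurityHamiltonian A α γ) =
        UnboundedOp.spectrum (RingChain.periodicHamiltonian A α)) ∧
    (0 < α → 0 < γ →
      ∀ z : ℂ, UnboundedOp.IsEigenvalue (RingChain.impurityHamiltonian A α γ) z →
        z ∈ UnboundedOp.essSpectrum (RingChain.impurityHamiltonian A α γ) ∧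
          ∃ n : ℕ, 1 ≤ n ∧ z = (n : ℂ) ^ 2) ∧
    (0 < α → γ < 0 →
      ∀ G : Set ℝ, UnboundedOp.IsGap (RingChain.impurityHamiltonian A α γ) G →
        UnboundedOp.HasUniqueSimpleEigenvalueIn (RingChain.impurityHamiltonian A α γ) G) ∧
    (α < 0 → 0 < γ →
      (∀ G : Set ℝ, UnboundedOp.IsGap (RingChain.impurityHamiltonian A α γ) G →
        G ≠ UnboundedOp.firstGap (RingChain.impurityHamiltonian A α γ) →
          UnboundedOp.HasUniqueSimpleEigenvalueIn (RingChain.impurityHamiltonian A α γ) G) ∧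
      ∀ x ∈ UnboundedOp.firstGap (RingChain.impurityHamiltonian A α γ),
        ¬ UnboundedOp.IsEigenvalue (RingChain.impurityHamiltonian A α γ) (x : ℂ)) ∧
    (α < 0 → γ < 0 →
      ∃ E ∈ UnboundedOp.firstGap (RingChain.impurityHamiltonian A α γ),
        UnboundedOp.IsSimpleEigenvalue (RingChain.impurityHamiltonian A α γ) (E : ℂ) ∧
        ∀ z : ℂ, UnboundedOp.IsEigenvalue (RingChain.impurityHamiltonian A α γ) z →
          z = (E : ℂ) ∨
          (z ∈ UnboundedOp.essSpectrum (RingChain.impurityHamiltonian A α γ) ∧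
          ∃ n : ℕ, 1 ≤ n ∧ z = (n : ℂ) ^ 2)) := by
  have hess := essSpectrum_impurityHamiltonian A α γ
  refine ⟨⟨?_, ?_⟩, fun hα hγ z hz => ?_, fun hα hγ G hG => ?_,
    fun hα hγ => ⟨fun G hG hne => ?_, fun x hx he => ?_⟩, fun hα hγ => ?_⟩
  · rw [hess, ← impurityHamiltonian_zero, essSpectrum_impurityHamiltonian]
  · rw [hess, spectrum_periodicHamiltonian]
  · refine (isEigenvalue_cases hz).resolve_right ?_
    rintro ⟨x, -, hx, hneg⟩
    exact hneg.not_gt (mul_pos hγ (realTanFactor_pos_of_notMem_band hα hx))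
  · obtain ⟨x, hx, rfl⟩ := (isGap_iff A α γ).1 hG
    exact hasUniqueSimpleEigenvalueIn A hx
      (mul_neg_of_neg_of_pos hγ (realTanFactor_pos_of_notMem_band hα hx))
  · obtain ⟨x, hx, rfl⟩ := (isGap_iff A α γ).1 hG
    refine hasUniqueSimpleEigenvalueIn A hx (mul_neg_of_pos_of_neg hγ ?_)
    exact realTanFactor_neg_of_notMem_firstGap hα hx (mt connectedComponentIn_eq_firstGap hne)
  · have hneg := ((isEigenvalue_ofReal_iff A (notMem_band_of_mem_firstGap hx)).1 he).2
    exact hneg.not_gt (mul_pos hγ (realTanFactor_pos_of_mem_firstGap hx))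
  · obtain ⟨E, hE, hsimple, hunique⟩ := hasUniqueSimpleEigenvalueIn_firstGap A α hγ
    refine ⟨E, hE, hsimple, fun z hz => (isEigenvalue_cases hz).symm.imp_left ?_⟩
    rintro ⟨x, rfl, hx, hneg⟩
    have hx_gap := (mem_firstGap_iff_realTanFactor_pos A γ hα hx).2
      (pos_of_mul_neg_right hneg hγ.le)
    rw [hunique x hx_gap hz]
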